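/- **Setting.** Let $F=F(x,y,p,q)$ be a smooth real function on an open set $U\subset\mathbb R^4$ with $F_{qq}\neq 0$ on $U$; it defines the third order ODE $y'''=F(x,y,y',y'')$ over $U$. Put $\omega^1=dy-p\,dx$, $\omega^2=dp-q\,dx$, $\omega^3=dq-F\,dx$, $\omega^4=dx$, let $$K=\tfrac16(F_{qx}+pF_{qy}+qF_{qp}+FF_{qq})-\tfrac19F_q^2-\tfrac12F_p ,$$ and let $\mathcal P_U=\{(x,y,p,q,\alpha,\gamma):(x,y,p,q)\in U,\ \alpha\ne0\}$, a 6-manifold with projection $\pi:\mathcal P_U\to U$. A fiber-preserving (f.p.) transformation is an invertible smooth transformation, with smooth inverse, $\bar x=X(x)$, $\bar y=Y(x,y)$; it is prolonged to $(x,y,p,q)\mapsto(\bar x,\bar y,\bar p,\bar q)$ by $\bar p=d\bar y/d\bar x$, $\bar q=d\bar p/d\bar x$. The ODE $F$ over $U$ and the ODE $\bar F$ over $\bar U$ are f.p. equivalent if such a transformation (defined over the projections of $U$ to the $x$-line and to the $(x,y)$-plane) has a prolongation carrying $U$ onto $\bar U$ and transforms the equations into each other; they are locally f.p. equivalent at $z\in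 U$ and $\bar z\in\bar U$ if this holds for some open neighbourhoods of $z$ and $\bar z$ by a transformation whose prolongation takes $z$ to $\bar z$. **Theorem.** Let $(F,U)$ and $(\bar F,\bar U)$ be two such ODEs, with $F_{qq}\ne0$ on $U$ and $\bar F_{\bar q\bar q}\neq0$ on $\bar U$. 1. The six 1-forms $$\begin{aligned} \theta^1&=\alpha\,\omega^1,\\ \theta^2&=\tfrac16F_{qq}(\omega^2+\gamma\,\omega^1),\\ \theta^3&=\tfrac{1}{36\alpha}F_{qq}^2\big(\omega^3+(\gamma-\tfrac13F_q)\omega^2+(\tfrac12\gamma^2+K)\omega^1\big),\\ \theta^4&=\tfrac{6\alpha}{F_{qq}}\,\omega^4,\\ \Omega^1&=\tfrac1{F_{qq}}\big(-F_{qqq}\gamma^2+(\tfrac23F_{qqq}F_q+\tfrac13F_{qq}^2+2F_{qqp})\gamma+F_{qq}K_q+2F_{qqq}K-2F_{qqy}\big)\omega^1-\gamma\,\omega^4+\tfrac1\alpha d\alpha,\\ \Omega^2&=-\tfrac1{6\alpha}F_{qq}(\tfrac12\gamma^2+\tfrac13F_q\gamma+K)\omega^4 +\tfrac1{6\alpha}\big(-\tfrac12F_{qqq}\gamma^2+(\tfrac13F_{qqq}F_q+F_{qqp})\gamma+F_{qqq}K-F_{qqy}\big)\omega^2\\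 &\quad+\tfrac1{6\alpha}\big(-\tfrac12F_{qqq}\gamma^3+(\tfrac16F_{qq}^2+\tfrac13F_{qqq}F_q+F_{qqp})\gamma^2+(F_{qq}K_q-F_{qqy}+F_{qqq}K)\gamma\\ &\qquad\quad-\tfrac13F_{qq}F_{qy}-F_{qq}K_p-\tfrac13F_{qq}F_qK_q+\tfrac13F_{qq}^2K\big)\omega^1+\tfrac1{6\alpha}F_{qq}\,d\gamma \end{aligned}$$ form a smooth coframe on $\mathcal P_U$. 2. This coframe is uniquely determined: among all 1-forms on $\mathcal P_U$ given by $\theta^1=\alpha\omega^1$, $\theta^2=\beta(\omega^2+\gamma\omega^1)$, $\theta^3=\epsilon(\omega^3+\eta\omega^2+\varkappa\omega^1)$, $\theta^4=\lambda\omega^4$, $\Omega^1$, $\Omega^2$, with $\beta,\epsilon,\eta,\varkappa,\lambda$ smooth functions on $\mathcal P_U$, $\beta\epsilon\lambda\ne0$, and $\Omega^1,\Omega^2$ smooth, the one in part 1 is the only one that satisfies, for some functions $a,b,c,e,f$ on $\mathcal P_U$, $$\begin{aligned} d\theta^1&=\Omega^1\wedge\theta^1+\theta^4\wedge\theta^2,\\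 d\theta^2&=\Omega^2\wedge\theta^1+a\,\theta^3\wedge\theta^2+b\,\theta^4\wedge\theta^2+\theta^4\wedge\theta^3,\\ d\theta^3&=\Omega^2\wedge\theta^2-\Omega^1\wedge\theta^3+(2-2c)\,\theta^3\wedge\theta^2+e\,\theta^4\wedge\theta^1+2b\,\theta^4\wedge\theta^3,\\ d\theta^4&=\Omega^1\wedge\theta^4+f\,\theta^4\wedge\theta^1+(c-2)\,\theta^4\wedge\theta^2+a\,\theta^4\wedge\theta^3 . \end{aligned}$$ 3. The coframe is invariant: every f.p. equivalence of $(F,U)$ with $(\bar F,\bar U)$ has exactly one lift to a diffeomorphism $\psi:\mathcal P_U\to\mathcal P_{\bar U}$ (covering its prolongation $U\to\bar U$) with $\psi^*\bar\theta^i=\theta^i$ $(i=1,\dots,4)$ and $\psi^*\bar\Omega^A=\Omega^A$ $(A=1,2)$. 4. For all $z\in U$, $\bar z\in\bar U$: the two ODEs are locally f.p. equivalent at $z$, $\bar z$ if and only if there is a diffeomorphism $\psi$ from an open subset of $\mathcal P_U$ onto an open subset of $\mathcal P_{\bar U}$, taking some point over $z$ to a point over $\bar z$, with $\psi^*\bar\theta^i=\theta^i$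 and $\psi^*\bar\Omega^A=\Omega^A$. 5. Suppose that $U$ is connected and that its fibers $U\cap\{x=s\}$ and $U\cap\{x=s,\,y=t\}$ are connected (or empty) for all $s,t$. Then the two ODEs are f.p. equivalent if and only if there is a diffeomorphism $\psi:\mathcal P_U\to\mathcal P_{\bar U}$ with $\psi^*\bar\theta^i=\theta^i$ and $\psi^*\bar\Omega^A=\Omega^A$. -/

import Mathlib

open Set
open scoped ContDiff

noncomputable section

namespace ThirdOrderODE

/-- Points `(x, y, p, q)` of the second jet space. -/
abbrev Jet : Type := Fin 4 → ℝ

/-- Coordinates `(x, y, p, q, α, γ)`. -/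
abbrev Six : Type := Fin 6 → ℝ

/-- Covectors on the six-dimensional space. -/
abbrev Covec : Type := Six →L[ℝ] ℝ

/-- The partial derivative of `f` with respect to the `i`-th of the coordinates `(x, y, p, q)`. -/
def pd (i : Fin 4) (f : Jet → ℝ) (z : Jet) : ℝ := fderiv ℝ f z (Pi.single i 1)

/-! ### Fiber-preserving transformations `x ↦ X x`, `(x, y) ↦ Y (x, y)` -/

/-- The new dependent variable, as a function of `(x, y, p, q)`. -/
def ybar (Y : ℝ × ℝ → ℝ) (z : Jet) : ℝ := Y (z 0, z 1)

/-- The new first derivative `dY / dX`. -/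
def pbar (X : ℝ → ℝ) (Y : ℝ × ℝ → ℝ) (z : Jet) : ℝ :=
  (pd 0 (ybar Y) z + z 2 * pd 1 (ybar Y) z) / deriv X (z 0)

/-- The new second derivative `d pbar / dX`. -/
def qbar (X : ℝ → ℝ) (Y : ℝ × ℝ → ℝ) (z : Jet) : ℝ :=
  (pd 0 (pbar X Y) z + z 2 * pd 1 (pbar X Y) z + z 3 * pd 2 (pbar X Y) z) / deriv X (z 0)

/-- The new third derivative `d qbar / dX`, along solutions of `y''' = F(x, y, y', y'')`. -/
def thirdbar (F : Jet → ℝ) (X : ℝ → ℝ) (Y : ℝ × ℝ → ℝ) (z : Jet) : ℝ :=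
  (pd 0 (qbar X Y) z + z 2 * pd 1 (qbar X Y) z + z 3 * pd 2 (qbar X Y) z
    + F z * pd 3 (qbar X Y) z) / deriv X (z 0)

/-- The prolongation of the transformation `(X, Y)` to second jets. -/
def prolong (X : ℝ → ℝ) (Y : ℝ × ℝ → ℝ) (z : Jet) : Jet :=
  ![X (z 0), ybar Y z, pbar X Y z, qbar X Y z]

/-- The `x`-coordinates of the points of `U`. -/
def baseX (U : Set Jet) : Set ℝ := (fun z : Jet => z 0) '' U

/-- The `(x, y)`-coordinates of the points of `U`. -/
def baseXY (U : Set Jet) : Set (ℝ × ℝ) := (fun z : Jet => (z 0, z 1)) '' U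

/-- `(X, Y)` is an invertible smooth fiber-preserving transformation (with smooth inverse) of the
variables over `U`; its prolongation carries `U` onto `U'` and it transforms the equation
`y''' = F` on `U` and the equation `y''' = F'` on `U'` into each other. -/
structure IsFPEquiv (F : Jet → ℝ) (U : Set Jet) (F' : Jet → ℝ) (U' : Set Jet)
    (X : ℝ → ℝ) (Y : ℝ × ℝ → ℝ) : Prop where
  smooth_X : ContDiffOn ℝ ∞ X (baseX U)
  smooth_Y : ContDiffOn ℝ ∞ Y (baseXY U)
  inj_X : InjOn X (baseX U)
  inj_XY : InjOn (fun w : ℝ × ℝ => (X w.1, Y w)) (baseXY U)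
  deriv_X_ne : ∀ z ∈ U, deriv X (z 0) ≠ 0
  deriv_Y_ne : ∀ z ∈ U, pd 1 (ybar Y) z ≠ 0
  image_eq : prolong X Y '' U = U'
  transforms : ∀ z ∈ U, F' (prolong X Y z) = thirdbar F X Y z

/-- The equations `y''' = F` on `U` and `y''' = F'` on `U'` are locally fiber-preserving
equivalent, by a transformation whose prolongation takes the jet `z` to the jet `z'`. -/
def LocallyFPEquivAt (F : Jet → ℝ) (U : Set Jet) (z : Jet)
    (F' : Jet → ℝ) (U' : Set Jet) (z' : Jet) : Prop :=
  ∃ (V V' : Set Jet) (X : ℝ → ℝ) (Y : ℝ × ℝ → ℝ),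
    IsOpen V ∧ V ⊆ U ∧ z ∈ V ∧ IsOpen V' ∧ V' ⊆ U' ∧ z' ∈ V' ∧
      IsFPEquiv F V F' V' X Y ∧ prolong X Y z = z'

/-! ### The manifold `P` and the coframe -/

/-- The projection `(x, y, p, q, α, γ) ↦ (x, y, p, q)`. -/
def jet (u : Six) : Jet := ![u 0, u 1, u 2, u 3]

/-- The 6-manifold `P` over `U`: an open subset of `ℝ⁶`. -/
def P (U : Set Jet) : Set Six := {u | jet u ∈ U ∧ u 4 ≠ 0}

/-- The coordinate differentials `dx, dy, dp, dq, dα, dγ`. -/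
def dc (i : Fin 6) : Covec := ContinuousLinearMap.proj i

/-- `ω¹ = dy - p dx`. -/
def om1 (u : Six) : Covec := dc 1 - u 2 • dc 0

/-- `ω² = dp - q dx`. -/
def om2 (u : Six) : Covec := dc 2 - u 3 • dc 0

/-- `ω³ = dq - F dx`. -/
def om3 (F : Jet → ℝ) (u : Six) : Covec := dc 3 - F (jet u) • dc 0

/-- `ω⁴ = dx`. -/
def om4 : Covec := dc 0

/-- Functions `β, ε, η, κ, lam` and 1-forms `Ω¹, Ω²` of the variables `(x, y, p, q, α, γ)`. -/
structure Reduction where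
  β : Six → ℝ
  ε : Six → ℝ
  η : Six → ℝ
  κ : Six → ℝ
  lam : Six → ℝ
  Om1 : Six → Covec
  Om2 : Six → Covec

namespace Reduction

/-- `θ¹ = α ω¹`. -/
def th1 (u : Six) : Covec := u 4 • om1 u

/-- `θ² = β (ω² + γ ω¹)`. -/
def th2 (R : Reduction) (u : Six) : Covec := R.β u • (om2 u + u 5 • om1 u)

/-- `θ³ = ε (ω³ + η ω² + κ ω¹)`. -/
def th3 (F : Jet → ℝ) (R : Reduction) (u : Six) : Covec :=
  R.ε u • (om3 F u + R.η u • om2 u + R.κ u • om1 u)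

/-- `θ⁴ = lam ω⁴`. -/
def th4 (R : Reduction) (u : Six) : Covec := R.lam u • om4

/-- The six forms `(θ¹, θ², θ³, θ⁴, Ω¹, Ω²)`. -/
def forms (F : Jet → ℝ) (R : Reduction) (u : Six) : Fin 6 → Covec :=
  ![th1 u, R.th2 u, R.th3 F u, R.th4 u, R.Om1 u, R.Om2 u]

end Reduction

/-- The exterior derivative of a 1-form, evaluated on a pair of vectors. -/
def extD (σ : Six → Covec) (u v w : Six) : ℝ :=
  extDeriv (fun u' => ContinuousAlternatingMap.ofSubsingleton ℝ Six ℝ (0 : Fin 1) (σ u')) u ![v, w]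

/-- The wedge product of two covectors, evaluated on a pair of vectors. -/
def wedge (σ τ : Covec) (v w : Six) : ℝ := σ v * τ w - σ w * τ v

/-- Smooth data on `P U`, with `β ε lam ≠ 0`, for which
`dθ¹ = Ω¹∧θ¹ + θ⁴∧θ²`,
`dθ² = Ω²∧θ¹ + a θ³∧θ² + b θ⁴∧θ² + θ⁴∧θ³`,
`dθ³ = Ω²∧θ² - Ω¹∧θ³ + (2-2c) θ³∧θ² + e θ⁴∧θ¹ + 2b θ⁴∧θ³`,
`dθ⁴ = Ω¹∧θ⁴ + f θ⁴∧θ¹ + (c-2) θ⁴∧θ² + a θ⁴∧θ³`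
on `P U`, with some functions `a, b, c, e, f`. -/
structure Reduction.IsNormalized (F : Jet → ℝ) (U : Set Jet) (R : Reduction) : Prop where
  smooth_β : ContDiffOn ℝ ∞ R.β (P U)
  smooth_ε : ContDiffOn ℝ ∞ R.ε (P U)
  smooth_η : ContDiffOn ℝ ∞ R.η (P U)
  smooth_κ : ContDiffOn ℝ ∞ R.κ (P U)
  smooth_lam : ContDiffOn ℝ ∞ R.lam (P U)
  smooth_Om1 : ContDiffOn ℝ ∞ R.Om1 (P U)
  smooth_Om2 : ContDiffOn ℝ ∞ R.Om2 (P U)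
  ne_zero : ∀ u ∈ P U, R.β u ≠ 0 ∧ R.ε u ≠ 0 ∧ R.lam u ≠ 0
  structure_eqs : ∃ a b c e f : Six → ℝ, ∀ u ∈ P U, ∀ v w : Six,
    extD Reduction.th1 u v w =
      wedge (R.Om1 u) (Reduction.th1 u) v w + wedge (R.th4 u) (R.th2 u) v w ∧
    extD R.th2 u v w =
      wedge (R.Om2 u) (Reduction.th1 u) v w + a u * wedge (R.th3 F u) (R.th2 u) v w
        + b u * wedge (R.th4 u) (R.th2 u) v w + wedge (R.th4 u) (R.th3 F u) v w ∧
    extD (R.th3 F) u v w =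
      wedge (R.Om2 u) (R.th2 u) v w - wedge (R.Om1 u) (R.th3 F u) v w
        + (2 - 2 * c u) * wedge (R.th3 F u) (R.th2 u) v w
        + e u * wedge (R.th4 u) (Reduction.th1 u) v w
        + 2 * b u * wedge (R.th4 u) (R.th3 F u) v w ∧
    extD R.th4 u v w =
      wedge (R.Om1 u) (R.th4 u) v w + f u * wedge (R.th4 u) (Reduction.th1 u) v w
        + (c u - 2) * wedge (R.th4 u) (R.th2 u) v w + a u * wedge (R.th4 u) (R.th3 F u) v w

/-- `K = (F_qx + p F_qy + q F_qp + F F_qq) / 6 - F_q² / 9 - F_p / 2`. -/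
def K (F : Jet → ℝ) (z : Jet) : ℝ :=
  1 / 6 * (pd 0 (pd 3 F) z + z 2 * pd 1 (pd 3 F) z + z 3 * pd 2 (pd 3 F) z
    + F z * pd 3 (pd 3 F) z) - 1 / 9 * pd 3 F z ^ 2 - 1 / 2 * pd 2 F z

/-- The form `Ω¹`. -/
def Omega1 (F : Jet → ℝ) (u : Six) : Covec :=
  let z := jet u
  let α := u 4
  let γ := u 5
  let Fq := pd 3 F z
  let Fqq := pd 3 (pd 3 F) z
  let Fqqq := pd 3 (pd 3 (pd 3 F)) z
  let Fqqp := pd 2 (pd 3 (pd 3 F)) z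
  let Fqqy := pd 1 (pd 3 (pd 3 F)) z
  let k := K F z
  let Kq := pd 3 (K F) z
  (1 / Fqq * (-Fqqq * γ ^ 2 + (2 / 3 * Fqqq * Fq + 1 / 3 * Fqq ^ 2 + 2 * Fqqp) * γ
      + Fqq * Kq + 2 * Fqqq * k - 2 * Fqqy)) • om1 u
    - γ • om4 + (1 / α) • dc 4

/-- The form `Ω²`. -/
def Omega2 (F : Jet → ℝ) (u : Six) : Covec :=
  let z := jet u
  let α := u 4
  let γ := u 5
  let Fq := pd 3 F z
  let Fqy := pd 1 (pd 3 F) z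
  let Fqq := pd 3 (pd 3 F) z
  let Fqqq := pd 3 (pd 3 (pd 3 F)) z
  let Fqqp := pd 2 (pd 3 (pd 3 F)) z
  let Fqqy := pd 1 (pd 3 (pd 3 F)) z
  let k := K F z
  let Kp := pd 2 (K F) z
  let Kq := pd 3 (K F) z
  (-(1 / (6 * α)) * Fqq * (1 / 2 * γ ^ 2 + 1 / 3 * Fq * γ + k)) • om4
    + (1 / (6 * α) * (-(1 / 2) * Fqqq * γ ^ 2 + (1 / 3 * Fqqq * Fq + Fqqp) * γ
        + Fqqq * k - Fqqy)) • om2 u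
    + (1 / (6 * α) * (-(1 / 2) * Fqqq * γ ^ 3
        + (1 / 6 * Fqq ^ 2 + 1 / 3 * Fqqq * Fq + Fqqp) * γ ^ 2
        + (Fqq * Kq - Fqqy + Fqqq * k) * γ
        - 1 / 3 * Fqq * Fqy - Fqq * Kp - 1 / 3 * Fqq * Fq * Kq + 1 / 3 * Fqq ^ 2 * k)) • om1 u
    + (1 / (6 * α) * Fqq) • dc 5

/-- The explicit values of the parameters and of the forms `Ω¹, Ω²`. -/
def canonical (F : Jet → ℝ) : Reduction where
  β u := 1 / 6 * pd 3 (pd 3 F) (jet u)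
  ε u := 1 / (36 * u 4) * pd 3 (pd 3 F) (jet u) ^ 2
  η u := u 5 - 1 / 3 * pd 3 F (jet u)
  κ u := 1 / 2 * u 5 ^ 2 + K F (jet u)
  lam u := 6 * u 4 / pd 3 (pd 3 F) (jet u)
  Om1 := Omega1 F
  Om2 := Omega2 F

/-- The coframe `(θ¹, θ², θ³, θ⁴, Ω¹, Ω²)` of the equation `y''' = F`. -/
def coframe (F : Jet → ℝ) (u : Six) : Fin 6 → Covec := (canonical F).forms F u

/-- The partial homeomorphism `ψ` is a diffeomorphism between its (open) source and target, and it
pulls the coframe of `F'` back to the coframe of `F`. -/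
structure IsCoframeIso (F F' : Jet → ℝ) (ψ : OpenPartialHomeomorph Six Six) : Prop where
  smooth : ContDiffOn ℝ ∞ ψ ψ.source
  smooth_symm : ContDiffOn ℝ ∞ ψ.symm ψ.target
  pullback : ∀ u ∈ ψ.source, ∀ i : Fin 6,
    (coframe F' (ψ u) i).comp (fderiv ℝ ψ u) = coframe F u i

end ThirdOrderODE

end

/-! The proof rests on the uniqueness of the normalized reduction. The structure equations are
evaluated on the `frame` dual to ω⁴, ω¹, ω², ω³, dα, dγ. The ω⁴∧ω² part of dθ¹ and the ω⁴∧ω³ part of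
dθ² give λβ = α and λε = β, so β determines λ and ε. The torsion coefficients are arranged so that b
and c can be eliminated from dθ³; what remains is η = γ − F_q/3, ∂_q η = −2β, and a formula for κ
containing the total derivative of η (`η_β_κ_relations`). Differentiating the first relation turns
the second into β = F_qq/6 and the third into κ = γ²/2 + K. With these parameters fixed, Ω¹ and Ω²
are first determined modulo θ¹, and dθ³ removes the remaining freedom (`StructureEqsAt.Om_unique`).
Existence is a direct verification (`structureEqsAt_canonical`); the only relations needed among the
derivatives of F are the definition of K and its q-derivative.

Invariance then costs no computation with Ω¹ and Ω². A fiber-preserving transformation multiplies dx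
by a function and acts triangularly on ω¹, ω², ω³. The action on α and γ is chosen so that θ¹ and θ²
keep their prescribed shape, and since d commutes with pullback, the pulled back coframe is a
normalized reduction for F. By uniqueness it is the canonical one
(`IsFPEquiv.coframe_comp_fderiv_lift`).

Conversely, let ψ match the coframes. Preservation of θ⁴ makes x̄ locally a function of x, and
preservation of θ¹ makes ȳ locally a function of (x, y). Since θ¹, θ², θ³ annihilate the total
derivative direction, ψ covers the prolongation of (X, Y) and carries one equation to the other
(`IsCoframeIso.covers_prolong`). Connected slices make X and Y well defined and, by Rolle's theorem,
injective (`IsCoframeIso.exists_isFPEquiv`). Small balls supply such slices for the local statement,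
and the half α > 0 of the manifold supplies them for the global one. -/

open Filter Topology

noncomputable section

namespace ThirdOrderODE

/-! ### Exterior derivatives of 1-forms. -/

/-- Covectors as alternating maps in one variable. -/
def covecToAlt : Covec →L[ℝ] Six [⋀^Fin 1]→L[ℝ] ℝ :=
  (ContinuousAlternatingMap.ofSubsingletonLIE (𝕜 := ℝ) (E := Six) (F := ℝ)
    (0 : Fin 1)).toContinuousLinearEquiv

theorem covecToAlt_apply (σ : Covec) :
    covecToAlt σ = ContinuousAlternatingMap.ofSubsingleton ℝ Six ℝ (0 : Fin 1) σ := rfl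

theorem covecToAlt_apply_apply (σ : Covec) (m : Fin 1 → Six) : covecToAlt σ m = σ (m 0) := rfl

/-- For a 1-form the alternating sum defining d has two terms of opposite sign. The rules for
constants, sums and products rest on this formula. -/
theorem extD_eq {σ : Six → Covec} {u : Six} (h : DifferentiableAt ℝ σ u) (v w : Six) :
    extD σ u v w = fderiv ℝ σ u v w - fderiv ℝ σ u w v := by
  have h1 : HasFDerivAt (fun u' => covecToAlt (σ u')) (covecToAlt ∘L fderiv ℝ σ u) u :=
    covecToAlt.hasFDerivAt.comp u h.hasFDerivAt
  simp only [extD, extDeriv, ← covecToAlt_apply]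
  rw [h1.fderiv, ContinuousAlternatingMap.alternatizeUncurryFin_apply]
  simp [Fin.sum_univ_two, covecToAlt_apply_apply, Fin.removeNth, sub_eq_add_neg]

theorem extD_congr {σ σ' : Six → Covec} {u : Six} (h : σ =ᶠ[𝓝 u] σ') : extD σ u = extD σ' u := by
  funext v w
  have h' : (fun u' => ContinuousAlternatingMap.ofSubsingleton ℝ Six ℝ (0 : Fin 1) (σ u'))
      =ᶠ[𝓝 u] fun u' => ContinuousAlternatingMap.ofSubsingleton ℝ Six ℝ (0 : Fin 1) (σ' u') := by
    filter_upwards [h] with x hx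
    rw [hx]
  simp only [extD, h'.extDeriv_eq]

/-- `σ` is differentiable at `u` with exterior derivative `τ`. -/
def HasExtD (σ : Six → Covec) (τ : Six → Six → ℝ) (u : Six) : Prop :=
  DifferentiableAt ℝ σ u ∧ ∀ v w, extD σ u v w = τ v w

theorem HasExtD.congr {σ : Six → Covec} {τ τ' : Six → Six → ℝ} {u : Six} (h : HasExtD σ τ u)
    (hτ : ∀ v w, τ v w = τ' v w) : HasExtD σ τ' u :=
  ⟨h.1, fun v w => (h.2 v w).trans (hτ v w)⟩

theorem HasExtD.const (c : Covec) (u : Six) : HasExtD (fun _ => c) (fun _ _ => 0) u :=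
  ⟨differentiableAt_const _, fun v w => by rw [extD_eq (differentiableAt_const _)]; simp⟩

theorem HasExtD.add {σ σ' : Six → Covec} {τ τ' : Six → Six → ℝ} {u : Six}
    (h : HasExtD σ τ u) (h' : HasExtD σ' τ' u) :
    HasExtD (fun u => σ u + σ' u) (fun v w => τ v w + τ' v w) u := by
  refine ⟨h.1.fun_add h'.1, fun v w => ?_⟩
  beta_reduce
  rw [← h.2, ← h'.2, extD_eq (h.1.fun_add h'.1), extD_eq h.1, extD_eq h'.1, fderiv_fun_add h.1 h'.1]
  simp only [add_apply]
  ring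

theorem HasExtD.smul {f : Six → ℝ} {L : Covec} {σ : Six → Covec} {τ : Six → Six → ℝ} {u : Six}
    (hf : HasFDerivAt f L u) (h : HasExtD σ τ u) :
    HasExtD (fun u => f u • σ u) (fun v w => wedge L (σ u) v w + f u * τ v w) u := by
  have h1 : HasFDerivAt (fun u => f u • σ u) _ u := hf.smul h.1.hasFDerivAt
  refine ⟨h1.differentiableAt, fun v w => ?_⟩
  beta_reduce
  rw [← h.2, extD_eq h1.differentiableAt, extD_eq h.1, h1.fderiv]
  simp [wedge]
  ring

/-! ### The contact forms and their exterior derivatives. -/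

/-- The total derivative along solutions of `y''' = F`. -/
def tot (F f : Jet → ℝ) (z : Jet) : ℝ :=
  pd 0 f z + z 2 * pd 1 f z + z 3 * pd 2 f z + F z * pd 3 f z

/-- `jet` as a continuous linear map. -/
def jetL : Six →L[ℝ] Jet := ContinuousLinearMap.pi ![dc 0, dc 1, dc 2, dc 3]

theorem jetL_apply (u : Six) : jetL u = jet u := by
  ext i; fin_cases i <;> rfl

@[simp] theorem jet_zero (u : Six) : jet u 0 = u 0 := rfl
@[simp] theorem jet_one (u : Six) : jet u 1 = u 1 := rfl
@[simp] theorem jet_two (u : Six) : jet u 2 = u 2 := rfl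
@[simp] theorem jet_three (u : Six) : jet u 3 = u 3 := rfl
@[simp] theorem dc_apply (i : Fin 6) (v : Six) : dc i v = v i := rfl

theorem hasFDerivAt_jet (u : Six) : HasFDerivAt jet jetL u := by
  have h : jet = jetL := funext fun u => (jetL_apply u).symm
  rw [h]
  exact jetL.hasFDerivAt

theorem contDiff_jet : ContDiff ℝ ∞ jet := by
  have h : jet = jetL := funext fun u => (jetL_apply u).symm
  rw [h]
  exact jetL.contDiff

theorem fderiv_jet_apply (f : Jet → ℝ) (z v : Jet) :
    fderiv ℝ f z v = v 0 * pd 0 f z + v 1 * pd 1 f z + v 2 * pd 2 f z + v 3 * pd 3 f z := by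
  have hv : v = ∑ i, v i • (Pi.single i (1 : ℝ) : Jet) := by
    ext j
    simp [Finset.sum_apply, Pi.single_apply]
  conv_lhs => rw [hv]
  simp [Fin.sum_univ_four, pd]

/-- Substitute dx = ω⁴, dy = ω¹ + pω⁴, dp = ω² + qω⁴, dq = ω³ + Fω⁴; the ω⁴ terms collect into the
total derivative. -/
theorem hasFDerivAt_comp_jet (F : Jet → ℝ) {f : Jet → ℝ} {u : Six}
    (hf : DifferentiableAt ℝ f (jet u)) :
    HasFDerivAt (fun u => f (jet u)) (tot F f (jet u) • om4 + pd 1 f (jet u) • om1 u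
      + pd 2 f (jet u) • om2 u + pd 3 f (jet u) • om3 F u) u := by
  have h : HasFDerivAt (fun u => f (jet u)) _ u := hf.hasFDerivAt.comp u (hasFDerivAt_jet u)
  refine h.congr_fderiv ?_
  ext v
  simp [fderiv_jet_apply, jetL_apply, tot, om1, om2, om3, om4]
  ring

theorem hasFDerivAt_coord (i : Fin 6) (u : Six) : HasFDerivAt (fun u : Six => u i) (dc i) u :=
  (dc i).hasFDerivAt

/-- Constant covectors are closed, so only df contributes. With `c'` equal to dx this covers dy − p
dx, dp − q dx and dq − F dx at once. -/
theorem HasExtD.const_sub_smul {f : Six → ℝ} {L : Covec} {u : Six} (hf : HasFDerivAt f L u)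
    (c c' : Covec) : HasExtD (fun u => c - f u • c') (fun v w => wedge c' L v w) u := by
  have h := (HasExtD.const c u).add (HasExtD.smul hf.neg (HasExtD.const c' u))
  have e : (fun u : Six => c + ((-f) u) • c') = fun u => c - f u • c' := by
    funext u
    ext v
    simp
    ring
  have h' : HasExtD (fun u => c - f u • c') _ u := e ▸ h
  refine h'.congr fun v w => ?_
  simp [wedge]
  ring

theorem hasExtD_om1 (u : Six) : HasExtD om1 (fun v w => wedge om4 (om2 u) v w) u :=
  (HasExtD.const_sub_smul (hasFDerivAt_coord 2 u) (dc 1) (dc 0)).congr fun v w => by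
    simp [wedge, om2, om4]
    ring

theorem hasExtD_om2 (F : Jet → ℝ) (u : Six) :
    HasExtD om2 (fun v w => wedge om4 (om3 F u) v w) u :=
  (HasExtD.const_sub_smul (hasFDerivAt_coord 3 u) (dc 2) (dc 0)).congr fun v w => by
    simp [wedge, om3, om4]
    ring

theorem hasExtD_om3 {F : Jet → ℝ} {u : Six} {L : Covec}
    (hF : HasFDerivAt (fun u => F (jet u)) L u) :
    HasExtD (om3 F) (fun v w => wedge om4 L v w) u :=
  HasExtD.const_sub_smul hF (dc 3) (dc 0)

theorem hasExtD_th1 (u : Six) : HasExtD Reduction.th1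
    (fun v w => wedge (dc 4) (om1 u) v w + u 4 * wedge om4 (om2 u) v w) u :=
  HasExtD.smul (hasFDerivAt_coord 4 u) (hasExtD_om1 u)

theorem hasExtD_th2 (F : Jet → ℝ) {R : Reduction} {u : Six} {L : Covec}
    (hβ : HasFDerivAt R.β L u) : HasExtD R.th2
    (fun v w => wedge L (om2 u + u 5 • om1 u) v w + R.β u * (wedge om4 (om3 F u) v w
      + (wedge (dc 5) (om1 u) v w + u 5 * wedge om4 (om2 u) v w))) u :=
  HasExtD.smul hβ ((hasExtD_om2 F u).add (HasExtD.smul (hasFDerivAt_coord 5 u) (hasExtD_om1 u)))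

theorem hasExtD_th3 {F : Jet → ℝ} {R : Reduction} {u : Six} {LF Lε Lη Lκ : Covec}
    (hF : HasFDerivAt (fun u => F (jet u)) LF u) (hε : HasFDerivAt R.ε Lε u)
    (hη : HasFDerivAt R.η Lη u) (hκ : HasFDerivAt R.κ Lκ u) : HasExtD (R.th3 F)
    (fun v w => wedge Lε (om3 F u + R.η u • om2 u + R.κ u • om1 u) v w
      + R.ε u * (wedge om4 LF v w
        + (wedge Lη (om2 u) v w + R.η u * wedge om4 (om3 F u) v w)
        + (wedge Lκ (om1 u) v w + R.κ u * wedge om4 (om2 u) v w))) u :=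
  HasExtD.smul hε (((hasExtD_om3 hF).add (HasExtD.smul hη (hasExtD_om2 F u))).add
    (HasExtD.smul hκ (hasExtD_om1 u)))

theorem hasExtD_th4 {R : Reduction} {u : Six} {L : Covec}
    (hlam : HasFDerivAt R.lam L u) : HasExtD R.th4 (fun v w => wedge L om4 v w) u :=
  (HasExtD.smul hlam (HasExtD.const om4 u)).congr fun v w => by simp

/-! ### Partial derivatives and the function K. -/

theorem contDiffOn_pd {f : Jet → ℝ} {U : Set Jet} (hU : IsOpen U) (hf : ContDiffOn ℝ ∞ f U)
    (i : Fin 4) : ContDiffOn ℝ ∞ (pd i f) U :=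
  (hf.fderiv_of_isOpen hU (m := ∞) (by simp)).clm_apply contDiffOn_const

theorem differentiableAt_of_contDiffOn {f : Jet → ℝ} {U : Set Jet} (hU : IsOpen U)
    (hf : ContDiffOn ℝ ∞ f U) {z : Jet} (hz : z ∈ U) : DifferentiableAt ℝ f z :=
  (hf.contDiffAt (hU.mem_nhds hz)).differentiableAt (by simp)

theorem pd_comm {f : Jet → ℝ} {U : Set Jet} (hU : IsOpen U) (hf : ContDiffOn ℝ ∞ f U)
    {z : Jet} (hz : z ∈ U) (i j : Fin 4) : pd i (pd j f) z = pd j (pd i f) z := by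
  have hc := hf.contDiffAt (hU.mem_nhds hz)
  have hs : IsSymmSndFDerivAt ℝ f z := hc.isSymmSndFDerivAt (by
    simpa using (ENat.LEInfty.out : (2 : WithTop ℕ∞) ≤ ∞))
  have hd : DifferentiableAt ℝ (fderiv ℝ f) z :=
    (hc.fderiv_right (m := ∞) (by simp)).differentiableAt (by simp)
  have key : ∀ i j : Fin 4, pd i (pd j f) z
      = fderiv ℝ (fderiv ℝ f) z (Pi.single i 1) (Pi.single j 1) := by
    intro i j
    have h : HasFDerivAt (pd j f) _ z :=
      hd.hasFDerivAt.clm_apply (hasFDerivAt_const (Pi.single j (1 : ℝ) : Jet) z)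
    conv_lhs => unfold pd
    erw [h.fderiv]
    simp
  rw [key, key]
  exact hs _ _

theorem pd_add {f g : Jet → ℝ} {z : Jet} (i : Fin 4) (hf : DifferentiableAt ℝ f z)
    (hg : DifferentiableAt ℝ g z) : pd i (fun z => f z + g z) z = pd i f z + pd i g z := by
  simp [pd, fderiv_fun_add hf hg]

theorem pd_sub {f g : Jet → ℝ} {z : Jet} (i : Fin 4) (hf : DifferentiableAt ℝ f z)
    (hg : DifferentiableAt ℝ g z) : pd i (fun z => f z - g z) z = pd i f z - pd i g z := by
  simp [pd, fderiv_fun_sub hf hg]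

theorem pd_mul {f g : Jet → ℝ} {z : Jet} (i : Fin 4) (hf : DifferentiableAt ℝ f z)
    (hg : DifferentiableAt ℝ g z) :
    pd i (fun z => f z * g z) z = f z * pd i g z + g z * pd i f z := by
  simp [pd, fderiv_fun_mul hf hg]

theorem pd_const_mul {f : Jet → ℝ} {z : Jet} (i : Fin 4) (c : ℝ) (hf : DifferentiableAt ℝ f z) :
    pd i (fun z => c * f z) z = c * pd i f z := by
  simp [pd, fderiv_const_mul hf]

theorem pd_coord (i j : Fin 4) (z : Jet) : pd i (fun z => z j) z = if j = i then 1 else 0 := by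
  have h : HasFDerivAt (fun z : Jet => z j) (ContinuousLinearMap.proj (R := ℝ) j) z :=
    (ContinuousLinearMap.proj (R := ℝ) (φ := fun _ : Fin 4 => ℝ) j).hasFDerivAt
  simp [pd, h.fderiv, Pi.single_apply]

theorem contDiffOn_tot {F f : Jet → ℝ} {U : Set Jet} (hU : IsOpen U) (hF : ContDiffOn ℝ ∞ F U)
    (hf : ContDiffOn ℝ ∞ f U) : ContDiffOn ℝ ∞ (tot F f) U := by
  have := contDiffOn_pd hU hf 0
  have := contDiffOn_pd hU hf 1
  have := contDiffOn_pd hU hf 2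
  have := contDiffOn_pd hU hf 3
  unfold tot
  fun_prop

/-- The coefficients q and F of the total derivative D depend on q, whence the commutator [∂_q, D] =
∂_p + F_q ∂_q. -/
theorem pd_three_tot {F f : Jet → ℝ} {U : Set Jet} (hU : IsOpen U) (hF : ContDiffOn ℝ ∞ F U)
    (hf : ContDiffOn ℝ ∞ f U) {z : Jet} (hz : z ∈ U) :
    pd 3 (tot F f) z = tot F (pd 3 f) z + pd 2 f z + pd 3 F z * pd 3 f z := by
  have hd : ∀ i, DifferentiableAt ℝ (pd i f) z := fun i =>
    differentiableAt_of_contDiffOn hU (contDiffOn_pd hU hf i) hz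
  have hdF := differentiableAt_of_contDiffOn hU hF hz
  have hx : ∀ i : Fin 4, DifferentiableAt ℝ (fun z : Jet => z i) z := fun i => by fun_prop
  have h0 := hd 0
  have h1 := hd 1
  have h2 := hd 2
  have h3 := hd 3
  unfold tot
  rw [pd_add 3 (by fun_prop) (by fun_prop), pd_add 3 (by fun_prop) (by fun_prop),
    pd_add 3 (by fun_prop) (by fun_prop), pd_mul 3 (hx 2) (hd 1), pd_mul 3 (hx 3) (hd 2),
    pd_mul 3 hdF (hd 3), pd_coord, pd_coord, pd_comm hU hf hz 3 0, pd_comm hU hf hz 3 1,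
    pd_comm hU hf hz 3 2]
  simp only [show (2 : Fin 4) ≠ 3 from by decide, if_true, if_false]
  ring

theorem K_eq (F : Jet → ℝ) : K F = fun z => 1 / 6 * tot F (pd 3 F) z
    - 1 / 9 * (pd 3 F z * pd 3 F z) - 1 / 2 * pd 2 F z := by
  funext z
  simp only [K, tot]
  ring

theorem contDiffOn_K {F : Jet → ℝ} {U : Set Jet} (hU : IsOpen U) (hF : ContDiffOn ℝ ∞ F U) :
    ContDiffOn ℝ ∞ (K F) U := by
  have := contDiffOn_tot hU hF (contDiffOn_pd hU hF 3)
  have := contDiffOn_pd hU hF 3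
  have := contDiffOn_pd hU hF 2
  rw [K_eq]
  fun_prop

/-- Differentiate the definition of K in q and commute ∂_q past D. This trades the total derivative
of F_qq, which appears in dβ, for the K_q in which Ω¹ and Ω² are written. -/
theorem tot_pd_three_pd_three {F : Jet → ℝ} {U : Set Jet} (hU : IsOpen U)
    (hF : ContDiffOn ℝ ∞ F U) {z : Jet} (hz : z ∈ U) :
    tot F (pd 3 (pd 3 F)) z = 6 * pd 3 (K F) z + 2 * pd 2 (pd 3 F) z
      + 1 / 3 * pd 3 F z * pd 3 (pd 3 F) z := by
  have hq := contDiffOn_pd hU hF 3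
  have h1 := differentiableAt_of_contDiffOn hU (contDiffOn_tot hU hF hq) hz
  have h2 := differentiableAt_of_contDiffOn hU hq hz
  have h3 := differentiableAt_of_contDiffOn hU (contDiffOn_pd hU hF 2) hz
  rw [K_eq, pd_sub 3 (by fun_prop) (by fun_prop), pd_sub 3 (by fun_prop) (by fun_prop),
    pd_const_mul 3 _ h1, pd_const_mul 3 _ (h2.fun_mul h2), pd_const_mul 3 _ h3, pd_mul 3 h2 h2,
    pd_three_tot hU hF hq hz, pd_comm hU hF hz 3 2]
  ring

/-! ### Smoothness and linear independence of the coframe. -/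

theorem isOpen_P {U : Set Jet} (hU : IsOpen U) : IsOpen (P U) :=
  (hU.preimage contDiff_jet.continuous).inter
    (isOpen_ne.preimage (continuous_apply (4 : Fin 6)))

theorem contDiffOn_comp_jet {f : Jet → ℝ} {U : Set Jet} (hf : ContDiffOn ℝ ∞ f U) :
    ContDiffOn ℝ ∞ (fun u => f (jet u)) (P U) :=
  hf.comp contDiff_jet.contDiffOn fun _ hu => hu.1

theorem contDiffOn_canonical_β {F : Jet → ℝ} {U : Set Jet} (hU : IsOpen U)
    (hF : ContDiffOn ℝ ∞ F U) : ContDiffOn ℝ ∞ (canonical F).β (P U) :=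
  contDiffOn_const.mul (contDiffOn_comp_jet (contDiffOn_pd hU (contDiffOn_pd hU hF 3) 3))

theorem contDiff_coord (i : Fin 6) : ContDiff ℝ ∞ (fun u : Six => u i) := contDiff_apply ℝ ℝ i

theorem contDiffOn_inv_coord_four (U : Set Jet) (c : ℝ) (hc : c ≠ 0) :
    ContDiffOn ℝ ∞ (fun u : Six => 1 / (c * u 4)) (P U) :=
  contDiffOn_const.div (contDiffOn_const.mul (contDiff_coord 4).contDiffOn)
    fun _ hu => mul_ne_zero hc hu.2

theorem contDiffOn_canonical_ε {F : Jet → ℝ} {U : Set Jet} (hU : IsOpen U)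
    (hF : ContDiffOn ℝ ∞ F U) : ContDiffOn ℝ ∞ (canonical F).ε (P U) :=
  (contDiffOn_inv_coord_four U 36 (by norm_num)).mul
    ((contDiffOn_comp_jet (contDiffOn_pd hU (contDiffOn_pd hU hF 3) 3)).pow 2)

theorem contDiffOn_canonical_η {F : Jet → ℝ} {U : Set Jet} (hU : IsOpen U)
    (hF : ContDiffOn ℝ ∞ F U) : ContDiffOn ℝ ∞ (canonical F).η (P U) :=
  (contDiff_coord 5).contDiffOn.sub
    (contDiffOn_const.mul (contDiffOn_comp_jet (contDiffOn_pd hU hF 3)))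

theorem contDiffOn_canonical_κ {F : Jet → ℝ} {U : Set Jet} (hU : IsOpen U)
    (hF : ContDiffOn ℝ ∞ F U) : ContDiffOn ℝ ∞ (canonical F).κ (P U) :=
  (contDiffOn_const.mul ((contDiff_coord 5).contDiffOn.pow 2)).add
    (contDiffOn_comp_jet (contDiffOn_K hU hF))

theorem contDiffOn_canonical_lam {F : Jet → ℝ} {U : Set Jet} (hU : IsOpen U)
    (hF : ContDiffOn ℝ ∞ F U) (hFqq : ∀ z ∈ U, pd 3 (pd 3 F) z ≠ 0) :
    ContDiffOn ℝ ∞ (canonical F).lam (P U) :=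
  (contDiffOn_const.mul (contDiff_coord 4).contDiffOn).div
    (contDiffOn_comp_jet (contDiffOn_pd hU (contDiffOn_pd hU hF 3) 3)) fun _ hu => hFqq _ hu.1

theorem contDiff_om1 : ContDiff ℝ ∞ om1 :=
  contDiff_const.sub ((contDiff_coord 2).smul contDiff_const)

theorem contDiff_om2 : ContDiff ℝ ∞ om2 :=
  contDiff_const.sub ((contDiff_coord 3).smul contDiff_const)

theorem contDiffOn_om3 {F : Jet → ℝ} {U : Set Jet} (hF : ContDiffOn ℝ ∞ F U) :
    ContDiffOn ℝ ∞ (om3 F) (P U) :=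
  contDiffOn_const.sub ((contDiffOn_comp_jet hF).smul contDiffOn_const)

theorem contDiffOn_Omega1 {F : Jet → ℝ} {U : Set Jet} (hU : IsOpen U)
    (hF : ContDiffOn ℝ ∞ F U) (hFqq : ∀ z ∈ U, pd 3 (pd 3 F) z ≠ 0) :
    ContDiffOn ℝ ∞ (Omega1 F) (P U) := by
  have hq := contDiffOn_pd hU hF 3
  have hqq := contDiffOn_pd hU hq 3
  have h1 := contDiffOn_comp_jet hq
  have h2 := contDiffOn_comp_jet hqq
  have h3 := contDiffOn_comp_jet (contDiffOn_pd hU hqq 1)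
  have h4 := contDiffOn_comp_jet (contDiffOn_pd hU hqq 2)
  have h5 := contDiffOn_comp_jet (contDiffOn_pd hU hqq 3)
  have h6 := contDiffOn_comp_jet (contDiffOn_K hU hF)
  have h7 := contDiffOn_comp_jet (contDiffOn_pd hU (contDiffOn_K hU hF) 3)
  have ha : ContDiffOn ℝ ∞ (fun u : Six => 1 / u 4) (P U) :=
    contDiffOn_const.div (contDiff_coord 4).contDiffOn fun _ hu => hu.2
  have hg : ContDiffOn ℝ ∞ (fun u : Six => 1 / pd 3 (pd 3 F) (jet u)) (P U) :=
    contDiffOn_const.div h2 fun _ hu => hFqq _ hu.1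
  have hγ : ContDiff ℝ ∞ (fun u : Six => u 5) := contDiff_coord 5
  have o1 := contDiff_om1
  -- With the two reciprocals named as functions already known to be smooth, the rest is polynomial
  -- and carries no nonvanishing conditions.
  obtain ⟨A, hA⟩ : ∃ A : Six → ℝ, A = fun u => 1 / u 4 := ⟨_, rfl⟩
  obtain ⟨B, hB⟩ : ∃ B : Six → ℝ, B = fun u => 1 / pd 3 (pd 3 F) (jet u) := ⟨_, rfl⟩
  unfold Omega1
  dsimp only
  simp only [← congrFun hA, ← congrFun hB]
  rw [← hA] at ha
  rw [← hB] at hg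
  fun_prop

theorem contDiffOn_Omega2 {F : Jet → ℝ} {U : Set Jet} (hU : IsOpen U)
    (hF : ContDiffOn ℝ ∞ F U) : ContDiffOn ℝ ∞ (Omega2 F) (P U) := by
  have hq := contDiffOn_pd hU hF 3
  have hqq := contDiffOn_pd hU hq 3
  have h1 := contDiffOn_comp_jet hq
  have h2 := contDiffOn_comp_jet hqq
  have h3 := contDiffOn_comp_jet (contDiffOn_pd hU hqq 1)
  have h4 := contDiffOn_comp_jet (contDiffOn_pd hU hqq 2)
  have h5 := contDiffOn_comp_jet (contDiffOn_pd hU hqq 3)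
  have h6 := contDiffOn_comp_jet (contDiffOn_K hU hF)
  have h7 := contDiffOn_comp_jet (contDiffOn_pd hU (contDiffOn_K hU hF) 3)
  have h8 := contDiffOn_comp_jet (contDiffOn_pd hU (contDiffOn_K hU hF) 2)
  have h9 := contDiffOn_comp_jet (contDiffOn_pd hU hq 1)
  have ha := contDiffOn_inv_coord_four U 6 (by norm_num)
  have hγ : ContDiff ℝ ∞ (fun u : Six => u 5) := contDiff_coord 5
  have o1 := contDiff_om1
  have o2 := contDiff_om2
  obtain ⟨A, hA⟩ : ∃ A : Six → ℝ, A = fun u => 1 / (6 * u 4) := ⟨_, rfl⟩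
  unfold Omega2
  dsimp only
  simp only [← congrFun hA]
  rw [← hA] at ha
  fun_prop

theorem contDiffOn_coframe {F : Jet → ℝ} {U : Set Jet} (hU : IsOpen U)
    (hF : ContDiffOn ℝ ∞ F U) (hFqq : ∀ z ∈ U, pd 3 (pd 3 F) z ≠ 0) (i : Fin 6) :
    ContDiffOn ℝ ∞ (fun u => coframe F u i) (P U) := by
  fin_cases i
  · exact ((contDiff_coord 4).smul contDiff_om1).contDiffOn
  · exact (contDiffOn_canonical_β hU hF).smul
      (contDiff_om2.add ((contDiff_coord 5).smul contDiff_om1)).contDiffOn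
  · exact (contDiffOn_canonical_ε hU hF).smul
      (((contDiffOn_om3 hF).add ((contDiffOn_canonical_η hU hF).smul contDiff_om2.contDiffOn)).add
        ((contDiffOn_canonical_κ hU hF).smul contDiff_om1.contDiffOn))
  · exact (contDiffOn_canonical_lam hU hF hFqq).smul contDiffOn_const
  · exact contDiffOn_Omega1 hU hF hFqq
  · exact contDiffOn_Omega2 hU hF

/-- The coframe is triangular: vanishing of θ¹, …, θ⁴ forces ω¹, …, ω⁴ to vanish in turn, after
which Ω¹ and Ω² reduce to nonzero multiples of dα and dγ. -/
theorem coframe_injective {F : Jet → ℝ} {u v : Six} (hα : u 4 ≠ 0)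
    (hG : pd 3 (pd 3 F) (jet u) ≠ 0) (h : ∀ i, coframe F u i v = 0) : v = 0 := by
  have h0 := h 0
  have h1 := h 1
  have h2 := h 2
  have h3 := h 3
  have h4 := h 4
  have h5 := h 5
  simp [coframe, Reduction.forms, Reduction.th1, Reduction.th2, Reduction.th3, Reduction.th4,
    canonical, hα, hG] at h0 h1 h2 h3
  rw [h0] at h1 h2
  have e2 : om2 u v = 0 := by simpa [hG] using h1
  have e3 : om3 F u v = 0 := by simpa [e2, hα, hG] using h2
  simp [coframe, Reduction.forms, canonical, Omega1, Omega2, h0, h3, e2, hα, hG] at h4 h5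
  simp [om4] at h3
  simp [om1, h3] at h0
  simp [om2, h3] at e2
  simp [om3, h3] at e3
  ext i
  fin_cases i <;> assumption

theorem linearIndependent_coframe {F : Jet → ℝ} {u : Six} (hα : u 4 ≠ 0)
    (hG : pd 3 (pd 3 F) (jet u) ≠ 0) : LinearIndependent ℝ (coframe F u) := by
  let Φ : Six →ₗ[ℝ] Six := LinearMap.pi fun i => (coframe F u i : Six →ₗ[ℝ] ℝ)
  have hinj : Function.Injective Φ := by
    rw [injective_iff_map_eq_zero]
    exact fun v hv => coframe_injective hα hG fun i => congrFun hv i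
  have hsurj := LinearMap.surjective_of_injective hinj
  rw [Fintype.linearIndependent_iff]
  intro c hc
  obtain ⟨v, hv⟩ := hsurj c
  -- The linear relation with coefficients `c` is evaluated on a vector whose coframe components are
  -- again `c`.
  have h1 : ∑ i, c i * c i = 0 := by
    have h2 := congrArg (fun σ : Covec => σ v) hc
    simp only [sum_apply, smul_apply, smul_eq_mul,
      zero_apply] at h2
    rw [← h2]
    exact Finset.sum_congr rfl fun i _ => by rw [← congrFun hv i]; rfl
  intro i
  have h3 := (Finset.sum_eq_zero_iff_of_nonneg fun i _ => mul_self_nonneg (c i)).1 h1 i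
    (Finset.mem_univ i)
  exact mul_self_eq_zero.1 h3

/-! ### The canonical reduction satisfies the structure equations. -/

/-- The differential of `f` as a function on the six-dimensional space. -/
def dJet (F f : Jet → ℝ) (u : Six) : Covec :=
  tot F f (jet u) • om4 + pd 1 f (jet u) • om1 u + pd 2 f (jet u) • om2 u
    + pd 3 f (jet u) • om3 F u

theorem hasFDerivAt_fun_inv {f : Six → ℝ} {L : Covec} {u : Six} (hf : HasFDerivAt f L u)
    (h : f u ≠ 0) : HasFDerivAt (fun u => (f u)⁻¹) (-(f u ^ 2)⁻¹ • L) u :=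
  (hasDerivAt_inv h).comp_hasFDerivAt u hf

section Differentials

variable {F : Jet → ℝ} {u : Six}

theorem hasFDerivAt_canonical_β (hG : DifferentiableAt ℝ (pd 3 (pd 3 F)) (jet u)) :
    HasFDerivAt (canonical F).β ((1 / 6 : ℝ) • dJet F (pd 3 (pd 3 F)) u) u :=
  (hasFDerivAt_comp_jet F hG).const_mul (1 / 6 : ℝ)

theorem hasFDerivAt_canonical_ε (hα : u 4 ≠ 0)
    (hG : DifferentiableAt ℝ (pd 3 (pd 3 F)) (jet u)) :
    HasFDerivAt (canonical F).ε ((pd 3 (pd 3 F) (jet u) / (18 * u 4)) • dJet F (pd 3 (pd 3 F)) u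
      - (pd 3 (pd 3 F) (jet u) ^ 2 / (36 * u 4 ^ 2)) • dc 4) u := by
  have h1 : HasFDerivAt (fun u : Six => (36 * u 4)⁻¹) _ u :=
    hasFDerivAt_fun_inv ((hasFDerivAt_coord 4 u).const_mul 36) (by simpa using hα)
  have h2 : HasFDerivAt (fun u => pd 3 (pd 3 F) (jet u)) (dJet F (pd 3 (pd 3 F)) u) u :=
    hasFDerivAt_comp_jet F hG
  have h3 := h1.fun_mul (h2.pow 2)
  have e : (canonical F).ε = fun u => (36 * u 4)⁻¹ * pd 3 (pd 3 F) (jet u) ^ 2 := by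
    funext u
    simp [canonical]
  rw [e]
  refine h3.congr_fderiv ?_
  ext v
  simp
  field_simp
  ring

theorem hasFDerivAt_canonical_η (hq : DifferentiableAt ℝ (pd 3 F) (jet u)) :
    HasFDerivAt (canonical F).η (dc 5 - (1 / 3 : ℝ) • dJet F (pd 3 F) u) u :=
  (hasFDerivAt_coord 5 u).sub ((hasFDerivAt_comp_jet F hq).const_mul (1 / 3 : ℝ))

theorem hasFDerivAt_canonical_κ (hK : DifferentiableAt ℝ (K F) (jet u)) :
    HasFDerivAt (canonical F).κ (u 5 • dc 5 + dJet F (K F) u) u := by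
  refine ((((hasFDerivAt_coord 5 u).pow 2).const_mul (1 / 2 : ℝ)).add
    (hasFDerivAt_comp_jet F hK)).congr_fderiv ?_
  ext v
  simp [dJet]
  ring

theorem hasFDerivAt_canonical_lam (hG0 : pd 3 (pd 3 F) (jet u) ≠ 0)
    (hG : DifferentiableAt ℝ (pd 3 (pd 3 F)) (jet u)) :
    HasFDerivAt (canonical F).lam ((6 / pd 3 (pd 3 F) (jet u)) • dc 4
      - (6 * u 4 / pd 3 (pd 3 F) (jet u) ^ 2) • dJet F (pd 3 (pd 3 F)) u) u := by
  have h2 : HasFDerivAt (fun u => pd 3 (pd 3 F) (jet u)) (dJet F (pd 3 (pd 3 F)) u) u :=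
    hasFDerivAt_comp_jet F hG
  have h3 := ((hasFDerivAt_coord 4 u).const_mul 6).fun_mul (hasFDerivAt_fun_inv h2 hG0)
  refine h3.congr_fderiv ?_
  ext v
  simp
  field_simp
  ring

end Differentials

/-- The structure equations, at the point `u`, with coefficients `a, b, c, e, f`. -/
def StructureEqsAt (F : Jet → ℝ) (R : Reduction) (a b c e f : ℝ) (u : Six) : Prop :=
  ∀ v w : Six,
    extD Reduction.th1 u v w =
      wedge (R.Om1 u) (Reduction.th1 u) v w + wedge (R.th4 u) (R.th2 u) v w ∧
    extD R.th2 u v w =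
      wedge (R.Om2 u) (Reduction.th1 u) v w + a * wedge (R.th3 F u) (R.th2 u) v w
        + b * wedge (R.th4 u) (R.th2 u) v w + wedge (R.th4 u) (R.th3 F u) v w ∧
    extD (R.th3 F) u v w =
      wedge (R.Om2 u) (R.th2 u) v w - wedge (R.Om1 u) (R.th3 F u) v w
        + (2 - 2 * c) * wedge (R.th3 F u) (R.th2 u) v w
        + e * wedge (R.th4 u) (Reduction.th1 u) v w
        + 2 * b * wedge (R.th4 u) (R.th3 F u) v w ∧
    extD R.th4 u v w =
      wedge (R.Om1 u) (R.th4 u) v w + f * wedge (R.th4 u) (Reduction.th1 u) v w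
        + (c - 2) * wedge (R.th4 u) (R.th2 u) v w + a * wedge (R.th4 u) (R.th3 F u) v w

/-- The coefficient of `ω¹` in `Ω¹`. -/
def mu (F : Jet → ℝ) (u : Six) : ℝ :=
  1 / pd 3 (pd 3 F) (jet u) * (-pd 3 (pd 3 (pd 3 F)) (jet u) * u 5 ^ 2
    + (2 / 3 * pd 3 (pd 3 (pd 3 F)) (jet u) * pd 3 F (jet u) + 1 / 3 * pd 3 (pd 3 F) (jet u) ^ 2
      + 2 * pd 2 (pd 3 (pd 3 F)) (jet u)) * u 5
    + pd 3 (pd 3 F) (jet u) * pd 3 (K F) (jet u) + 2 * pd 3 (pd 3 (pd 3 F)) (jet u) * K F (jet u)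
    - 2 * pd 1 (pd 3 (pd 3 F)) (jet u))

/-- The coefficient `a` of the structure equations of the canonical reduction. -/
def coefA (F : Jet → ℝ) (u : Six) : ℝ :=
  36 * u 4 * pd 3 (pd 3 (pd 3 F)) (jet u) / pd 3 (pd 3 F) (jet u) ^ 3

/-- The coefficient `b` of the structure equations of the canonical reduction. -/
def coefB (F : Jet → ℝ) (u : Six) : ℝ :=
  (tot F (pd 3 (pd 3 F)) (jet u) / 6 + pd 3 (pd 3 F) (jet u) * pd 3 F (jet u) / 18) / u 4

/-- The coefficient `c` of the structure equations of the canonical reduction. -/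
def coefC (F : Jet → ℝ) (u : Six) : ℝ :=
  2 + 6 * (pd 2 (pd 3 (pd 3 F)) (jet u)
    - pd 3 (pd 3 (pd 3 F)) (jet u) * (u 5 - 1 / 3 * pd 3 F (jet u))) / pd 3 (pd 3 F) (jet u) ^ 2

/-- The coefficient `f` of the structure equations of the canonical reduction. -/
def coefF (F : Jet → ℝ) (u : Six) : ℝ :=
  (pd 1 (pd 3 (pd 3 F)) (jet u) / pd 3 (pd 3 F) (jet u) + mu F u
    - (pd 2 (pd 3 (pd 3 F)) (jet u)
      - pd 3 (pd 3 (pd 3 F)) (jet u) * (u 5 - 1 / 3 * pd 3 F (jet u))) * u 5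
        / pd 3 (pd 3 F) (jet u)
    - pd 3 (pd 3 (pd 3 F)) (jet u) * (1 / 2 * u 5 ^ 2 + K F (jet u))
      / pd 3 (pd 3 F) (jet u)) / u 4

/-- The coefficient `e` of the structure equations of the canonical reduction. -/
def coefE (F : Jet → ℝ) (u : Six) : ℝ :=
  (pd 3 (pd 3 F) (jet u) / (18 * u 4) * tot F (pd 3 (pd 3 F)) (jet u)
      * (1 / 2 * u 5 ^ 2 + K F (jet u))
    + pd 3 (pd 3 F) (jet u) ^ 2 / (36 * u 4) * (pd 1 F (jet u) + tot F (K F) (jet u))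
    + pd 3 (pd 3 F) (jet u) ^ 2 / (36 * u 4) * u 5
      * (1 / 2 * u 5 ^ 2 + 1 / 3 * pd 3 F (jet u) * u 5 + K F (jet u))
    - u 5 * (pd 3 (pd 3 F) (jet u) ^ 2 / (36 * u 4)) * (1 / 2 * u 5 ^ 2 + K F (jet u))
    - coefB F u * pd 3 (pd 3 F) (jet u) / 3 * (1 / 2 * u 5 ^ 2 + K F (jet u)))
    * pd 3 (pd 3 F) (jet u) / (6 * u 4 ^ 2)

theorem structureEqsAt_canonical {F : Jet → ℝ} {U : Set Jet} (hU : IsOpen U)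
    (hF : ContDiffOn ℝ ∞ F U) (hFqq : ∀ z ∈ U, pd 3 (pd 3 F) z ≠ 0) {u : Six} (hu : u ∈ P U) :
    StructureEqsAt F (canonical F) (coefA F u) (coefB F u) (coefC F u) (coefE F u) (coefF F u)
      u := by
  have hα := hu.2
  have hG0 := hFqq _ hu.1
  have hq := contDiffOn_pd hU hF 3
  have hqq := contDiffOn_pd hU hq 3
  have dF := differentiableAt_of_contDiffOn hU hF hu.1
  have dq := differentiableAt_of_contDiffOn hU hq hu.1
  have dqq := differentiableAt_of_contDiffOn hU hqq hu.1
  have dK := differentiableAt_of_contDiffOn hU (contDiffOn_K hU hF) hu.1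
  have hFj : HasFDerivAt (fun u => F (jet u)) (dJet F F u) u := hasFDerivAt_comp_jet F dF
  -- Once these two relations are substituted, the remaining derivatives of F and K can be treated
  -- as independent variables, and each structure equation becomes a rational identity.
  have r1 := tot_pd_three_pd_three hU hF hu.1
  have r2 : pd 2 F (jet u) = 1 / 3 * tot F (pd 3 F) (jet u) - 2 / 9 * pd 3 F (jet u) ^ 2
      - 2 * K F (jet u) := by
    rw [K_eq]
    ring
  intro v w
  rw [(hasExtD_th1 u).2, (hasExtD_th2 F (hasFDerivAt_canonical_β dqq)).2,
    (hasExtD_th3 hFj (hasFDerivAt_canonical_ε hα dqq) (hasFDerivAt_canonical_η dq)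
      (hasFDerivAt_canonical_κ dK)).2,
    (hasExtD_th4 (hasFDerivAt_canonical_lam hG0 dqq)).2]
  simp only [wedge, Reduction.th1, Reduction.th2, Reduction.th3, Reduction.th4, canonical,
    Omega1, Omega2, dJet, coefF, coefE, mu, coefA, coefB, coefC, add_apply, sub_apply, smul_apply,
    smul_eq_mul, dc_apply]
  rw [r1, r2]
  generalize om1 u v = v1
  generalize om1 u w = w1
  generalize om2 u v = v2
  generalize om2 u w = w2
  generalize om3 F u v = v3
  generalize om3 F u w = w3
  generalize om4 v = v4
  generalize om4 w = w4
  generalize v 4 = v5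
  generalize w 4 = w5
  generalize v 5 = v6
  generalize w 5 = w6
  generalize pd 3 (pd 3 F) (jet u) = G at *
  generalize pd 3 (pd 3 (pd 3 F)) (jet u) = G3 at *
  generalize pd 2 (pd 3 (pd 3 F)) (jet u) = G2 at *
  generalize pd 1 (pd 3 (pd 3 F)) (jet u) = G1 at *
  generalize pd 3 (K F) (jet u) = K3 at *
  generalize pd 2 (K F) (jet u) = K2 at *
  generalize pd 1 (K F) (jet u) = K1 at *
  generalize tot F (K F) (jet u) = K0 at *
  generalize K F (jet u) = k at *
  generalize tot F (pd 3 F) (jet u) = q0 at *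
  generalize pd 1 (pd 3 F) (jet u) = q1 at *
  generalize pd 2 (pd 3 F) (jet u) = q2 at *
  generalize pd 3 F (jet u) = q at *
  generalize pd 1 F (jet u) = F1 at *
  generalize tot F F (jet u) = F0 at *
  generalize u 4 = α at *
  generalize u 5 = γ at *
  clear hFj dF dq dqq dK hq hqq r1 r2 hu hF hFqq hU
  refine ⟨?_, ?_, ?_, ?_⟩
  · field_simp
    ring
  · field_simp
    ring
  · field_simp
    ring
  · field_simp
    ring

theorem isNormalized_canonical {F : Jet → ℝ} {U : Set Jet} (hU : IsOpen U)
    (hF : ContDiffOn ℝ ∞ F U) (hFqq : ∀ z ∈ U, pd 3 (pd 3 F) z ≠ 0) :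
    (canonical F).IsNormalized F U where
  smooth_β := contDiffOn_canonical_β hU hF
  smooth_ε := contDiffOn_canonical_ε hU hF
  smooth_η := contDiffOn_canonical_η hU hF
  smooth_κ := contDiffOn_canonical_κ hU hF
  smooth_lam := contDiffOn_canonical_lam hU hF hFqq
  smooth_Om1 := contDiffOn_Omega1 hU hF hFqq
  smooth_Om2 := contDiffOn_Omega2 hU hF
  ne_zero u hu := by
    have h4 := hu.2
    have hG := hFqq _ hu.1
    simp [canonical, h4, hG]
  structure_eqs := ⟨coefA F, coefB F, coefC F, coefE F, coefF F,
    fun _ hu => structureEqsAt_canonical hU hF hFqq hu⟩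

/-! ### Uniqueness of the normalized reduction. -/

/-- The frame of vector fields dual to `ω⁴, ω¹, ω², ω³, dα, dγ`. -/
def frame (F : Jet → ℝ) (u : Six) : Fin 6 → Six :=
  ![![1, u 2, u 3, F (jet u), 0, 0], ![0, 1, 0, 0, 0, 0], ![0, 0, 1, 0, 0, 0],
    ![0, 0, 0, 1, 0, 0], ![0, 0, 0, 0, 1, 0], ![0, 0, 0, 0, 0, 1]]

section Frame

variable (F : Jet → ℝ) (u : Six)

@[simp] theorem om1_frame (i : Fin 6) : om1 u (frame F u i) = if i = 1 then 1 else 0 := by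
  fin_cases i <;> simp [om1, frame]

@[simp] theorem om2_frame (i : Fin 6) : om2 u (frame F u i) = if i = 2 then 1 else 0 := by
  fin_cases i <;> simp [om2, frame]

@[simp] theorem om3_frame (i : Fin 6) : om3 F u (frame F u i) = if i = 3 then 1 else 0 := by
  fin_cases i <;> simp [om3, frame]

@[simp] theorem om4_frame (i : Fin 6) : om4 (frame F u i) = if i = 0 then 1 else 0 := by
  fin_cases i <;> simp [om4, frame]

@[simp] theorem frame_four (i : Fin 6) : frame F u i 4 = if i = 4 then 1 else 0 := by
  fin_cases i <;> simp [frame]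

@[simp] theorem frame_five (i : Fin 6) : frame F u i 5 = if i = 5 then 1 else 0 := by
  fin_cases i <;> simp [frame]

theorem covec_ext_frame {σ τ : Covec} (h : ∀ i, σ (frame F u i) = τ (frame F u i)) : σ = τ := by
  ext v
  have hv : v = v 0 • frame F u 0 + (v 1 - u 2 * v 0) • frame F u 1
      + (v 2 - u 3 * v 0) • frame F u 2 + (v 3 - F (jet u) * v 0) • frame F u 3
      + v 4 • frame F u 4 + v 5 • frame F u 5 := by
    ext i
    fin_cases i <;> simp [frame] <;> ring
  rw [hv]
  simp only [map_add, map_smul, h]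

end Frame

/-- These are the ω⁴∧ω² part of dθ¹ and the ω⁴∧ω³ part of dθ², where neither Ω¹, Ω² nor the unknown
torsion enters. -/
theorem lam_mul_β_and_lam_mul_ε {F : Jet → ℝ} {R : Reduction} {u : Six} {a b c e f : ℝ}
    {Lβ : Covec} (hβ : HasFDerivAt R.β Lβ u) (hS : StructureEqsAt F R a b c e f u) :
    R.lam u * R.β u = u 4 ∧ R.lam u * R.ε u = R.β u := by
  have h1 := (hS (frame F u 0) (frame F u 2)).1
  have h2 := (hS (frame F u 0) (frame F u 3)).2.1
  rw [(hasExtD_th1 u).2] at h1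
  rw [(hasExtD_th2 F hβ).2] at h2
  simp [wedge, Reduction.th1, Reduction.th2, Reduction.th3, Reduction.th4] at h1 h2
  exact ⟨h1.symm, h2.symm⟩

/-- The structure equations determine `η`, `β` and `κ`. -/
theorem η_β_κ_relations {F : Jet → ℝ} {R : Reduction} {u : Six} {a b c e f : ℝ}
    {LF Lβ Lε Lη Lκ Llam : Covec} (hα : u 4 ≠ 0) (hβ0 : R.β u ≠ 0)
    (hFj : HasFDerivAt (fun u => F (jet u)) LF u) (hβ : HasFDerivAt R.β Lβ u)
    (hε : HasFDerivAt R.ε Lε u) (hη : HasFDerivAt R.η Lη u) (hκ : HasFDerivAt R.κ Lκ u)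
    (hlam : HasFDerivAt R.lam Llam u)
    (eε : Lε = (2 * R.β u / u 4) • Lβ - (R.β u ^ 2 / u 4 ^ 2) • dc 4)
    (elam : Llam = (R.β u)⁻¹ • dc 4 - (u 4 / R.β u ^ 2) • Lβ)
    (hS : StructureEqsAt F R a b c e f u) :
    R.η u = u 5 - 1 / 3 * LF (frame F u 3) ∧
    Lη (frame F u 3) = -2 * R.β u ∧
    2 * R.κ u = u 5 * (R.η u - u 5) + (LF (frame F u 3) + R.η u) * R.η u - LF (frame F u 2)
      - Lη (frame F u 0) := by
  obtain ⟨l1, l2⟩ := lam_mul_β_and_lam_mul_ε hβ hS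
  have vlam : R.lam u = u 4 / R.β u := by field_simp; linarith
  have vε : R.ε u = R.β u ^ 2 / u 4 := by
    rw [vlam] at l2
    field_simp at l2 ⊢
    linarith
  have d1 := fun i j => (hS (frame F u i) (frame F u j)).1
  have d2 := fun i j => (hS (frame F u i) (frame F u j)).2.1
  have d3 := fun i j => (hS (frame F u i) (frame F u j)).2.2.1
  have d4 := fun i j => (hS (frame F u i) (frame F u j)).2.2.2
  simp only [(hasExtD_th1 u).2, (hasExtD_th2 F hβ).2, (hasExtD_th3 hFj hε hη hκ).2,
    (hasExtD_th4 hlam).2, wedge, Reduction.th1, Reduction.th2, Reduction.th3, Reduction.th4,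
    add_apply, smul_apply, smul_eq_mul, dc_apply, om1_frame, om2_frame, om3_frame, om4_frame,
    frame_four, frame_five] at d1 d2 d3 d4
  have m0 := d1 0 1
  have m2 := d1 2 1
  have m3 := d1 3 1
  have b0 := d2 0 2
  have b3 := d2 3 2
  have n0 := d2 0 1
  have n3 := d2 3 1
  have c2 := d4 0 2
  have e3 := d3 0 3
  have q := d3 3 2
  have p := d3 0 2
  simp [hα] at m0 m2 m3 b0 b3 n0 n3 c2 e3 q p
  rw [eε] at e3 q p
  rw [elam] at c2
  simp at e3 q p c2
  rw [m2] at c2 q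
  rw [m3] at q
  rw [vlam] at m0 b0 n0 c2 e3 p
  rw [vε] at b0 b3 n0 n3 e3 q p c2
  clear d1 d2 d3 d4 hS hFj hβ hε hη hκ hlam eε elam l1 l2 vlam vε m2 m3
  generalize R.β u = β at *
  generalize R.η u = η at *
  generalize R.κ u = κ at *
  generalize u 4 = α at *
  generalize u 5 = γ at *
  generalize LF (frame F u 3) = F3 at *
  generalize LF (frame F u 2) = F2 at *
  generalize Lη (frame F u 3) = η3 at *
  generalize Lη (frame F u 0) = η0 at *
  generalize Lβ (frame F u 0) = β0 at *
  generalize Lβ (frame F u 2) = β2 at *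
  generalize Lβ (frame F u 3) = β3 at *
  generalize R.Om1 u (frame F u 0) = M0 at *
  generalize R.Om2 u (frame F u 0) = N0 at *
  generalize R.Om2 u (frame F u 3) = N3 at *
  have hM0 : M0 = -γ := by
    field_simp at m0
    apply mul_left_cancel₀ hα
    linear_combination -m0
  have hβ0' : β0 = b * α + β * (η - γ) := by
    field_simp at b0
    linear_combination b0
  have hN0 : N0 = β * (γ * (η - γ) - κ) / α := by
    field_simp at n0 ⊢
    linear_combination -n0 + γ * hβ0'
  have hN3 : N3 = 0 := by
    rw [b3] at n3
    have : N3 * α = 0 := by linear_combination -n3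
    simpa [hα] using this
  have hβ2 : β2 = (c - 2) * β ^ 2 + β3 * η := by
    rw [b3]
    field_simp at c2 ⊢
    linear_combination c2
  -- In the ω⁴∧ω³ part of dθ³ the unknown b enters through 2b and through dε. As ε = β²/α, the
  -- derivative of ε carries twice the b found in that of β, so b cancels.
  have hη : η = γ - 1 / 3 * F3 := by
    rw [hβ0', hM0] at e3
    field_simp at e3
    apply mul_left_cancel₀ hβ0
    linear_combination (1 / 3) * e3
  refine ⟨hη, ?_, ?_⟩
  -- In the ω³∧ω² part of dθ³ the coefficient 2 − 2c meets 2(c − 2), coming from dε; c cancels and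
  -- the constant −2 survives.
  · rw [hβ2, hN3] at q
    field_simp at q
    apply mul_left_cancel₀ hβ0
    linear_combination q
  -- The ω⁴∧ω² part of dθ³, with the ω⁴ components of Ω¹ and Ω² and the derivative of β substituted,
  -- can be solved for κ.
  · rw [hβ0', hN0, hM0] at p
    field_simp at p
    apply mul_left_cancel₀ hβ0
    linear_combination p - 3 * β * η * hη

/-- The structure equations determine `Ω¹` and `Ω²`, given the other data. -/
theorem StructureEqsAt.Om_unique {F : Jet → ℝ} {R R' : Reduction} {u : Six}
    {a b c e f a' b' c' e' f' : ℝ} (hα : u 4 ≠ 0) (hβ : R.β u ≠ 0) (hε : R.ε u ≠ 0)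
    (hlam : R.lam u ≠ 0) (eβ : R'.β =ᶠ[𝓝 u] R.β) (eε : R'.ε =ᶠ[𝓝 u] R.ε)
    (eη : R'.η =ᶠ[𝓝 u] R.η) (eκ : R'.κ =ᶠ[𝓝 u] R.κ) (elam : R'.lam =ᶠ[𝓝 u] R.lam)
    (hS : StructureEqsAt F R a b c e f u) (hS' : StructureEqsAt F R' a' b' c' e' f' u) :
    R'.Om1 u = R.Om1 u ∧ R'.Om2 u = R.Om2 u := by
  have t2 : R'.th2 =ᶠ[𝓝 u] R.th2 := by
    filter_upwards [eβ] with x hx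
    simp only [Reduction.th2, hx]
  have t3 : R'.th3 F =ᶠ[𝓝 u] R.th3 F := by
    filter_upwards [eε, eη, eκ] with x h1 h2 h3
    simp only [Reduction.th3, h1, h2, h3]
  have t4 : R'.th4 =ᶠ[𝓝 u] R.th4 := by
    filter_upwards [elam] with x h1
    simp only [Reduction.th4, h1]
  have d1 := fun i j => ((hS' (frame F u i) (frame F u j)).1).symm.trans
    (hS (frame F u i) (frame F u j)).1
  have d2 := fun i j => (hS' (frame F u i) (frame F u j)).2.1
  have d3 := fun i j => (hS' (frame F u i) (frame F u j)).2.2.1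
  have d4 := fun i j => (hS' (frame F u i) (frame F u j)).2.2.2
  simp only [extD_congr t2, extD_congr t3, extD_congr t4, (hS _ _).2.1, (hS _ _).2.2.1,
    (hS _ _).2.2.2] at d2 d3 d4
  simp only [eβ.eq_of_nhds, eε.eq_of_nhds, eη.eq_of_nhds, eκ.eq_of_nhds, elam.eq_of_nhds,
    wedge, Reduction.th1, Reduction.th2, Reduction.th3, Reduction.th4, add_apply, smul_apply, smul_eq_mul, om1_frame, om2_frame,
    om3_frame, om4_frame] at d1 d2 d3 d4
  -- Pairing with the ω¹ direction in dθ¹ gives Ω¹ modulo θ¹. Then a and b come from dθ², c from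
  -- dθ⁴, and dθ² gives Ω² modulo θ¹.
  have m : ∀ i, i ≠ 1 → R'.Om1 u (frame F u i) = R.Om1 u (frame F u i) := by
    intro i hi
    have h := d1 i 1
    simp only [hi, if_true, if_false] at h
    exact mul_right_cancel₀ hα (by linear_combination h)
  have ha : a' = a := by
    have h := d2 3 2
    simp [hβ, hε] at h
    exact h.symm
  have hb : b' = b := by
    have h := d2 0 2
    simp [hβ, hlam] at h
    exact h.symm
  have hc : c' = c := by
    have h := d4 0 2
    simp [ha, m, hβ, hlam] at h
    exact h.symm
  have n : ∀ i, i ≠ 1 → R'.Om2 u (frame F u i) = R.Om2 u (frame F u i) := by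
    intro i hi
    have h := d2 i 1
    simp only [ha, hb, hi, if_true, if_false] at h
    exact mul_right_cancel₀ hα (by linear_combination -h)
  -- Adding multiples of θ¹ to Ω¹ and Ω² would create θ¹∧θ³ and θ¹∧θ² terms in dθ³, for which no
  -- free torsion coefficient is available.
  have m1 : R'.Om1 u (frame F u 1) = R.Om1 u (frame F u 1) := by
    have h := d3 3 1
    simp [hc, hb, n, m, hε] at h
    exact h.symm
  have n1 : R'.Om2 u (frame F u 1) = R.Om2 u (frame F u 1) := by
    have h := d3 2 1
    simp [hc, hb, n, m, m1, hβ] at h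
    exact h.symm
  constructor <;> refine covec_ext_frame F u fun i => ?_ <;> by_cases hi : i = 1
  · rw [hi, m1]
  · exact m i hi
  · rw [hi, n1]
  · exact n i hi

/-- A normalized reduction is the canonical one. -/
theorem Reduction.IsNormalized.eq_canonical {F : Jet → ℝ} {U : Set Jet} {R : Reduction}
    (hU : IsOpen U) (hF : ContDiffOn ℝ ∞ F U) (hFqq : ∀ z ∈ U, pd 3 (pd 3 F) z ≠ 0)
    (hR : R.IsNormalized F U) {u : Six} (hu : u ∈ P U) :
    R.β u = (canonical F).β u ∧ R.ε u = (canonical F).ε u ∧ R.η u = (canonical F).η u ∧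
      R.κ u = (canonical F).κ u ∧ R.lam u = (canonical F).lam u ∧
      R.Om1 u = (canonical F).Om1 u ∧ R.Om2 u = (canonical F).Om2 u := by
  obtain ⟨a, b, c, e, f, hS⟩ := hR.structure_eqs
  have hP := isOpen_P hU
  have hd : ∀ {g : Six → ℝ}, ContDiffOn ℝ ∞ g (P U) → ∀ u ∈ P U,
      HasFDerivAt g (fderiv ℝ g u) u := fun hg u hu =>
    ((hg.contDiffAt (hP.mem_nhds hu)).differentiableAt (by simp)).hasFDerivAt
  have hS' : ∀ u ∈ P U, StructureEqsAt F R (a u) (b u) (c u) (e u) (f u) u := hS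
  have hrel : ∀ u ∈ P U, R.lam u * R.β u = u 4 ∧ R.lam u * R.ε u = R.β u := fun u hu =>
    lam_mul_β_and_lam_mul_ε (hd hR.smooth_β u hu) (hS' u hu)
  have vlam : ∀ u ∈ P U, R.lam u = u 4 * (R.β u)⁻¹ := fun u hu => by
    have h1 := (hR.ne_zero u hu).1
    have h2 := hrel u hu
    field_simp
    linarith
  have vε : ∀ u ∈ P U, R.ε u = (u 4)⁻¹ * R.β u ^ 2 := fun u hu => by
    have h1 := hR.ne_zero u hu
    have h2 := (hrel u hu).2
    have h3 := (hrel u hu).1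
    have h4 := hu.2
    rw [← h3] at h4 ⊢
    rw [← h2]
    field_simp [h1]
  have dJ : ∀ {g : Jet → ℝ}, ContDiffOn ℝ ∞ g U → ∀ u ∈ P U,
      HasFDerivAt (fun u => g (jet u)) (dJet F g u) u := fun hg u hu =>
    hasFDerivAt_comp_jet F (differentiableAt_of_contDiffOn hU hg hu.1)
  have fr : ∀ (g : Jet → ℝ) (u : Six), dJet F g u (frame F u 0) = tot F g (jet u) ∧
      dJet F g u (frame F u 2) = pd 2 g (jet u) ∧ dJet F g u (frame F u 3) = pd 3 g (jet u) := by
    intro g u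
    simp [dJet]
  have rel : ∀ u ∈ P U, R.η u = u 5 - 1 / 3 * pd 3 F (jet u) ∧
      fderiv ℝ R.η u (frame F u 3) = -2 * R.β u ∧
      2 * R.κ u = u 5 * (R.η u - u 5) + (pd 3 F (jet u) + R.η u) * R.η u - pd 2 F (jet u)
        - fderiv ℝ R.η u (frame F u 0) := by
    intro u hu
    have hβ := hd hR.smooth_β u hu
    have hα := hu.2
    have hβ0 := (hR.ne_zero u hu).1
    -- The algebraic relations hold on an open set, so dε and dλ are determined by dβ and dα.
    have dε : HasFDerivAt R.ε ((2 * R.β u / u 4) • fderiv ℝ R.β u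
        - (R.β u ^ 2 / u 4 ^ 2) • dc 4) u := by
      have h := (hasFDerivAt_fun_inv (hasFDerivAt_coord 4 u) hα).fun_mul (hβ.pow 2)
      refine (h.congr_of_eventuallyEq ?_).congr_fderiv ?_
      · filter_upwards [hP.mem_nhds hu] with x hx using vε x hx
      · ext v
        simp
        field_simp
        ring
    have dlam : HasFDerivAt R.lam ((R.β u)⁻¹ • dc 4 - (u 4 / R.β u ^ 2) • fderiv ℝ R.β u) u := by
      have h := (hasFDerivAt_coord 4 u).fun_mul (hasFDerivAt_fun_inv hβ hβ0)
      refine (h.congr_of_eventuallyEq ?_).congr_fderiv ?_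
      · filter_upwards [hP.mem_nhds hu] with x hx using vlam x hx
      · ext v
        simp
        field_simp
        ring
    have h := η_β_κ_relations hα hβ0 (dJ hF u hu) hβ dε (hd hR.smooth_η u hu)
      (hd hR.smooth_κ u hu) dlam rfl rfl (hS' u hu)
    rwa [(fr F u).2.1, (fr F u).2.2] at h
  have hq := contDiffOn_pd hU hF 3
  have eη : ∀ u ∈ P U, R.η u = (canonical F).η u := fun u hu => (rel u hu).1
  -- As η is now explicit on an open set, its derivatives along the frame are too: the one along q
  -- yields β, the total derivative yields κ.
  have dη : ∀ u ∈ P U, fderiv ℝ R.η u = dc 5 - (1 / 3 : ℝ) • dJet F (pd 3 F) u := by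
    intro u hu
    refine HasFDerivAt.fderiv ((hasFDerivAt_canonical_η
      (differentiableAt_of_contDiffOn hU hq hu.1)).congr_of_eventuallyEq ?_)
    filter_upwards [hP.mem_nhds hu] with x hx using eη x hx
  have eβ : ∀ u ∈ P U, R.β u = (canonical F).β u := by
    intro u hu
    have h := (rel u hu).2.1
    rw [dη u hu] at h
    simp [fr] at h
    simp only [canonical]
    linear_combination -(1 / 2) * h
  have eκ : ∀ u ∈ P U, R.κ u = (canonical F).κ u := by
    intro u hu
    have h := (rel u hu).2.2
    rw [dη u hu, (rel u hu).1] at h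
    simp [fr] at h
    simp only [canonical, K_eq]
    linear_combination (1 / 2) * h
  have elam : ∀ u ∈ P U, R.lam u = (canonical F).lam u := by
    intro u hu
    have hG := hFqq _ hu.1
    rw [vlam u hu, eβ u hu]
    simp only [canonical]
    field_simp
  have eε : ∀ u ∈ P U, R.ε u = (canonical F).ε u := by
    intro u hu
    have hα := hu.2
    rw [vε u hu, eβ u hu]
    simp only [canonical]
    field_simp
    ring
  have ev : ∀ {g h : Six → ℝ}, (∀ u ∈ P U, g u = h u) → g =ᶠ[𝓝 u] h := by
    intro g h hgh
    filter_upwards [hP.mem_nhds hu] with x hx using hgh x hx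
  obtain ⟨h1, h2, h3⟩ := (isNormalized_canonical hU hF hFqq).ne_zero u hu
  have hO := (structureEqsAt_canonical hU hF hFqq hu).Om_unique hu.2 h1 h2 h3 (ev eβ) (ev eε)
    (ev eη) (ev eκ) (ev elam) (hS' u hu)
  exact ⟨eβ u hu, eε u hu, eη u hu, eκ u hu, elam u hu, hO.1, hO.2⟩

/-! ### Prolongation of fiber-preserving transformations. -/

/-- `f` does not depend on the `j`-th coordinate. -/
def Indep (j : Fin 4) (f : Jet → ℝ) : Prop := ∀ (z : Jet) (t : ℝ), f (z + Pi.single j t) = f z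

theorem hasDerivAt_line {f : Jet → ℝ} {z : Jet} (hf : DifferentiableAt ℝ f z) (j : Fin 4) :
    HasDerivAt (fun t : ℝ => f (z + Pi.single j t)) (pd j f z) 0 := by
  have h1 : HasDerivAt (fun t : ℝ => z + t • (Pi.single j 1 : Jet)) (Pi.single j 1) 0 := by
    simpa using ((hasDerivAt_id (0 : ℝ)).smul_const (Pi.single j 1 : Jet)).const_add z
  have h2 : HasFDerivAt f (fderiv ℝ f z) (z + (0 : ℝ) • (Pi.single j 1 : Jet)) := by
    simpa using hf.hasFDerivAt
  have h3 := h2.comp_hasDerivAt (0 : ℝ) h1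
  refine h3.congr_of_eventuallyEq (Eventually.of_forall fun t => ?_)
  simp [← Pi.single_smul]

theorem Indep.pd {j : Fin 4} {f : Jet → ℝ} (h : Indep j f) (i : Fin 4) : Indep j (pd i f) := by
  intro z t
  have h1 : (fun z => f (z + Pi.single j t)) = f := funext fun z => h z t
  unfold ThirdOrderODE.pd
  conv_rhs => rw [← h1]
  rw [fderiv_comp_add_right]

/-- Differentiability is not needed: where it fails, the partial derivative is zero by convention.
-/
theorem Indep.pd_eq_zero {j : Fin 4} {f : Jet → ℝ} (h : Indep j f) (z : Jet) :
    ThirdOrderODE.pd j f z = 0 := by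
  by_cases hf : DifferentiableAt ℝ f z
  · have h1 := hasDerivAt_line hf j
    simp only [h z] at h1
    exact h1.unique (hasDerivAt_const _ _)
  · simp [ThirdOrderODE.pd, fderiv_zero_of_not_differentiableAt hf]

/-- Along the `j`-th coordinate line `A`, `B` and `C` are constant and f is affine. This applies to
p̄ as a function of p and to q̄ as a function of q. -/
theorem pd_affine {j : Fin 4} {f A B C : Jet → ℝ} (hA : Indep j A) (hB : Indep j B)
    (hC : Indep j C) (h : ∀ z, f z = (A z + z j * B z) / C z) {z : Jet}
    (hf : DifferentiableAt ℝ f z) : pd j f z = B z / C z := by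
  have h1 := hasDerivAt_line hf j
  have h2 : HasDerivAt (fun t : ℝ => (A z + (z j + t) * B z) / C z) (1 * B z / C z) 0 :=
    ((((hasDerivAt_id (0 : ℝ)).const_add (z j)).mul_const (B z)).const_add (A z)).div_const (C z)
  have e : (fun t : ℝ => f (z + Pi.single j t)) = fun t => (A z + (z j + t) * B z) / C z := by
    funext t
    rw [h, hA, hB, hC]
    simp
  rw [e] at h1
  simpa using h1.unique h2

section Prolongation

variable (X : ℝ → ℝ) (Y : ℝ × ℝ → ℝ)

theorem indep_two_ybar : Indep 2 (ybar Y) := fun z t => by simp [ybar]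

theorem indep_three_ybar : Indep 3 (ybar Y) := fun z t => by simp [ybar]

theorem indep_two_deriv : Indep 2 (fun z => deriv X (z 0)) := fun z t => by simp

theorem indep_three_deriv : Indep 3 (fun z => deriv X (z 0)) := fun z t => by simp

theorem indep_three_pbar : Indep 3 (pbar X Y) := fun z t => by
  simp [pbar, (indep_three_ybar Y).pd _ z t]

variable {X Y}

theorem pd_two_pbar {z : Jet} (h : DifferentiableAt ℝ (pbar X Y) z) :
    pd 2 (pbar X Y) z = pd 1 (ybar Y) z / deriv X (z 0) :=
  pd_affine ((indep_two_ybar Y).pd 0) ((indep_two_ybar Y).pd 1) (indep_two_deriv X)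
    (fun _ => rfl) h

theorem pd_three_qbar {z : Jet} (h : DifferentiableAt ℝ (qbar X Y) z) :
    pd 3 (qbar X Y) z = pd 2 (pbar X Y) z / deriv X (z 0) := by
  have hi := indep_three_pbar X Y
  refine pd_affine (A := fun z => pd 0 (pbar X Y) z + z 2 * pd 1 (pbar X Y) z) (fun z t => ?_)
    (hi.pd 2) (indep_three_deriv X) (fun _ => rfl) h
  simp [hi.pd _ z t]

/-- As ȳ depends on neither p nor q, its total derivative involves no F, and the quotient defining
p̄ is that derivative divided by X'. The next two lemmas repeat this for q̄ and the third
derivative. -/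
theorem tot_ybar (F : Jet → ℝ) {z : Jet} (h : deriv X (z 0) ≠ 0) :
    tot F (ybar Y) z = deriv X (z 0) * pbar X Y z := by
  simp only [tot, pbar, (indep_two_ybar Y).pd_eq_zero, (indep_three_ybar Y).pd_eq_zero]
  field_simp
  ring

theorem tot_pbar (F : Jet → ℝ) {z : Jet} (h : deriv X (z 0) ≠ 0) :
    tot F (pbar X Y) z = deriv X (z 0) * qbar X Y z := by
  simp only [tot, qbar, (indep_three_pbar X Y).pd_eq_zero]
  field_simp
  ring

theorem tot_qbar (F : Jet → ℝ) {z : Jet} (h : deriv X (z 0) ≠ 0) :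
    tot F (qbar X Y) z = deriv X (z 0) * thirdbar F X Y z := by
  simp only [tot, thirdbar]
  field_simp

/-- The projection to the `x`-coordinate. -/
def projX : Jet →L[ℝ] ℝ := ContinuousLinearMap.proj 0

/-- The projection to the `(x, y)`-coordinates. -/
def projXY : Jet →L[ℝ] ℝ × ℝ := (ContinuousLinearMap.proj 0).prod (ContinuousLinearMap.proj 1)

theorem isOpen_baseX {U : Set Jet} (hU : IsOpen U) : IsOpen (baseX U) :=
  projX.isOpenMap (fun s => ⟨![s, 0, 0, 0], rfl⟩) U hU

variable {U : Set Jet}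

theorem contDiffOn_ybar (hY : ContDiffOn ℝ ∞ Y (baseXY U)) : ContDiffOn ℝ ∞ (ybar Y) U :=
  hY.comp projXY.contDiff.contDiffOn fun z hz => ⟨z, hz, rfl⟩

theorem contDiffOn_comp_projX (hX : ContDiffOn ℝ ∞ X (baseX U)) :
    ContDiffOn ℝ ∞ (fun z : Jet => X (z 0)) U :=
  hX.comp projX.contDiff.contDiffOn fun z hz => ⟨z, hz, rfl⟩

theorem contDiffOn_deriv_X (hU : IsOpen U) (hX : ContDiffOn ℝ ∞ X (baseX U)) :
    ContDiffOn ℝ ∞ (fun z : Jet => deriv X (z 0)) U :=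
  contDiffOn_comp_projX (hX.deriv_of_isOpen (isOpen_baseX hU) (m := ∞) (by simp))

theorem contDiffOn_coord (i : Fin 4) : ContDiffOn ℝ ∞ (fun z : Jet => z i) U :=
  (contDiff_apply ℝ ℝ i).contDiffOn

theorem contDiffOn_pbar (hU : IsOpen U) (hX : ContDiffOn ℝ ∞ X (baseX U))
    (hY : ContDiffOn ℝ ∞ Y (baseXY U)) (hX0 : ∀ z ∈ U, deriv X (z 0) ≠ 0) :
    ContDiffOn ℝ ∞ (pbar X Y) U :=
  ((contDiffOn_pd hU (contDiffOn_ybar hY) 0).add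
    ((contDiffOn_coord 2).mul (contDiffOn_pd hU (contDiffOn_ybar hY) 1))).div
    (contDiffOn_deriv_X hU hX) hX0

theorem contDiffOn_qbar (hU : IsOpen U) (hX : ContDiffOn ℝ ∞ X (baseX U))
    (hY : ContDiffOn ℝ ∞ Y (baseXY U)) (hX0 : ∀ z ∈ U, deriv X (z 0) ≠ 0) :
    ContDiffOn ℝ ∞ (qbar X Y) U := by
  have hp := contDiffOn_pbar hU hX hY hX0
  exact (((contDiffOn_pd hU hp 0).add ((contDiffOn_coord 2).mul (contDiffOn_pd hU hp 1))).add
    ((contDiffOn_coord 3).mul (contDiffOn_pd hU hp 2))).div (contDiffOn_deriv_X hU hX) hX0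

theorem pd_comp_projX {z : Jet} (hX : DifferentiableAt ℝ X (z 0)) (i : Fin 4) :
    pd i (fun z => X (z 0)) z = if i = 0 then deriv X (z 0) else 0 := by
  have h : HasFDerivAt (fun z : Jet => X (z 0)) (deriv X (z 0) • projX) z :=
    hX.hasDerivAt.comp_hasFDerivAt z projX.hasFDerivAt
  rw [pd, h.fderiv]
  simp [projX, Pi.single_apply, eq_comm]

end Prolongation

/-! ### Pullback of forms along maps covering a prolongation. -/

theorem dc_comp_fderiv (F : Jet → ℝ) {ψ : Six → Six} {u : Six} (hψ : DifferentiableAt ℝ ψ u)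
    {f : Jet → ℝ} (hf : DifferentiableAt ℝ f (jet u)) {i : Fin 6}
    (h : ∀ᶠ u' in 𝓝 u, ψ u' i = f (jet u')) : (dc i).comp (fderiv ℝ ψ u) = dJet F f u := by
  have h1 : HasFDerivAt (fun u' => ψ u' i) ((dc i).comp (fderiv ℝ ψ u)) u :=
    (dc i).hasFDerivAt.comp u hψ.hasFDerivAt
  have h2 : HasFDerivAt (fun u' => f (jet u')) (dJet F f u) u := hasFDerivAt_comp_jet F hf
  exact h1.unique (h2.congr_of_eventuallyEq h)

/-- The pullbacks of `ω⁴, ω¹, ω², ω³` by a map covering a prolongation. -/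
theorem comp_fderiv_of_covers {F F' : Jet → ℝ} {U : Set Jet} {X : ℝ → ℝ} {Y : ℝ × ℝ → ℝ}
    (hU : IsOpen U) (hX : ContDiffOn ℝ ∞ X (baseX U)) (hY : ContDiffOn ℝ ∞ Y (baseXY U))
    (hX0 : ∀ z ∈ U, deriv X (z 0) ≠ 0) (ht : ∀ z ∈ U, F' (prolong X Y z) = thirdbar F X Y z)
    {ψ : Six → Six} {u : Six} (hu : jet u ∈ U) (hψ : DifferentiableAt ℝ ψ u)
    (hc : ∀ᶠ u' in 𝓝 u, jet (ψ u') = prolong X Y (jet u')) :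
    om4.comp (fderiv ℝ ψ u) = deriv X (u 0) • om4 ∧
    (om1 (ψ u)).comp (fderiv ℝ ψ u) = pd 1 (ybar Y) (jet u) • om1 u ∧
    (om2 (ψ u)).comp (fderiv ℝ ψ u) =
      pd 1 (pbar X Y) (jet u) • om1 u + pd 2 (pbar X Y) (jet u) • om2 u ∧
    (om3 F' (ψ u)).comp (fderiv ℝ ψ u) = pd 1 (qbar X Y) (jet u) • om1 u
      + pd 2 (qbar X Y) (jet u) • om2 u + pd 3 (qbar X Y) (jet u) • om3 F u := by
  have hX1 := hX0 _ hu
  have dX : DifferentiableAt ℝ X (jet u 0) :=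
    (hX.contDiffAt ((isOpen_baseX hU).mem_nhds ⟨_, hu, rfl⟩)).differentiableAt (by simp)
  have x0 : ∀ᶠ u' in 𝓝 u, ψ u' 0 = (fun z : Jet => X (z 0)) (jet u') :=
    hc.mono fun u' h => congrFun h 0
  have x1 : ∀ᶠ u' in 𝓝 u, ψ u' 1 = ybar Y (jet u') := hc.mono fun u' h => congrFun h 1
  have x2 : ∀ᶠ u' in 𝓝 u, ψ u' 2 = pbar X Y (jet u') := hc.mono fun u' h => congrFun h 2
  have x3 : ∀ᶠ u' in 𝓝 u, ψ u' 3 = qbar X Y (jet u') := hc.mono fun u' h => congrFun h 3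
  have c0 := dc_comp_fderiv F hψ
    (differentiableAt_of_contDiffOn hU (contDiffOn_comp_projX hX) hu) x0
  have c1 := dc_comp_fderiv F hψ (differentiableAt_of_contDiffOn hU (contDiffOn_ybar hY) hu) x1
  have c2 := dc_comp_fderiv F hψ
    (differentiableAt_of_contDiffOn hU (contDiffOn_pbar hU hX hY hX0) hu) x2
  have c3 := dc_comp_fderiv F hψ
    (differentiableAt_of_contDiffOn hU (contDiffOn_qbar hU hX hY hX0) hu) x3
  have e0 : (dc 0).comp (fderiv ℝ ψ u) = deriv X (u 0) • om4 := by
    rw [c0]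
    simp [dJet, tot, pd_comp_projX dX]
  have v2 := x2.self_of_nhds
  have v3 := x3.self_of_nhds
  have vF : F' (jet (ψ u)) = thirdbar F X Y (jet u) := by rw [hc.self_of_nhds, ht _ hu]
  -- In each contact form the ω⁴ terms cancel, because Dȳ = X'p̄, Dp̄ = X'q̄ and Dq̄ = X'F̄; the
  -- last is the transformation law of the equation.
  refine ⟨e0, ?_, ?_, ?_⟩
  · rw [om1, ContinuousLinearMap.sub_comp, ContinuousLinearMap.smul_comp, e0, c1, v2, dJet,
      tot_ybar F hX1, (indep_two_ybar Y).pd_eq_zero, (indep_three_ybar Y).pd_eq_zero]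
    ext v
    simp
    ring
  · rw [om2, ContinuousLinearMap.sub_comp, ContinuousLinearMap.smul_comp, e0, c2, v3, dJet,
      tot_pbar F hX1, (indep_three_pbar X Y).pd_eq_zero]
    ext v
    simp
    ring
  · rw [om3, ContinuousLinearMap.sub_comp, ContinuousLinearMap.smul_comp, e0, c3, vF, dJet,
      tot_qbar F hX1]
    ext v
    simp
    ring

/-- Naturality of d, transported through the identification of covectors with alternating 1-forms.
-/
theorem extD_pullback {σ : Six → Covec} {ψ : Six → Six} {u : Six}
    (hσ : DifferentiableAt ℝ σ (ψ u)) (hψ : ContDiffAt ℝ ∞ ψ u) (v w : Six) :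
    extD (fun u => (σ (ψ u)).comp (fderiv ℝ ψ u)) u v w
      = extD σ (ψ u) (fderiv ℝ ψ u v) (fderiv ℝ ψ u w) := by
  have h := extDeriv_pullback
    (show DifferentiableAt ℝ (fun u => covecToAlt (σ u)) (ψ u) from
      covecToAlt.differentiableAt.comp _ hσ) hψ
    (by simpa using (ENat.LEInfty.out : (2 : WithTop ℕ∞) ≤ ∞))
  have h' := congrArg (fun τ => τ ![v, w]) h
  have e : ![fderiv ℝ ψ u v, fderiv ℝ ψ u w] = fderiv ℝ ψ u ∘ ![v, w] := by
    ext i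
    fin_cases i <;> rfl
  rw [extD, extD, e]
  exact h'

/-! ### The lift of an equivalence and invariance of the coframe. -/

section Lift

variable (X : ℝ → ℝ) (Y : ℝ × ℝ → ℝ)

/-- The lift of the prolongation of `(X, Y)` to the six-dimensional space. -/
def lift (u : Six) : Six :=
  ![X (u 0), ybar Y (jet u), pbar X Y (jet u), qbar X Y (jet u), u 4 / pd 1 (ybar Y) (jet u),
    u 5 / deriv X (u 0) - pd 1 (pbar X Y) (jet u) / pd 1 (ybar Y) (jet u)]

theorem jet_lift (u : Six) : jet (lift X Y u) = prolong X Y (jet u) := rfl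

theorem lift_four (u : Six) : lift X Y u 4 = u 4 / pd 1 (ybar Y) (jet u) := rfl

theorem lift_five (u : Six) : lift X Y u 5
    = u 5 / deriv X (u 0) - pd 1 (pbar X Y) (jet u) / pd 1 (ybar Y) (jet u) := rfl

/-- The pullback of the canonical reduction of `F'` by the lift of `(X, Y)`. -/
def pullbackReduction (F' : Jet → ℝ) : Reduction where
  β u := (canonical F').β (lift X Y u) * pd 2 (pbar X Y) (jet u)
  ε u := (canonical F').ε (lift X Y u) * pd 3 (qbar X Y) (jet u)
  η u := (pd 2 (qbar X Y) (jet u) + (canonical F').η (lift X Y u) * pd 2 (pbar X Y) (jet u))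
    / pd 3 (qbar X Y) (jet u)
  κ u := (pd 1 (qbar X Y) (jet u) + (canonical F').η (lift X Y u) * pd 1 (pbar X Y) (jet u)
    + (canonical F').κ (lift X Y u) * pd 1 (ybar Y) (jet u)) / pd 3 (qbar X Y) (jet u)
  lam u := (canonical F').lam (lift X Y u) * deriv X (u 0)
  Om1 u := (Omega1 F' (lift X Y u)).comp (fderiv ℝ (lift X Y) u)
  Om2 u := (Omega2 F' (lift X Y u)).comp (fderiv ℝ (lift X Y) u)

variable {X Y} {F F' : Jet → ℝ} {U U' : Set Jet}

namespace IsFPEquiv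

theorem deriv_X_ne' (h : IsFPEquiv F U F' U' X Y) {u : Six} (hu : u ∈ P U) :
    deriv X (u 0) ≠ 0 := h.deriv_X_ne _ hu.1

theorem contDiffOn_pbar (h : IsFPEquiv F U F' U' X Y) (hU : IsOpen U) :
    ContDiffOn ℝ ∞ (pbar X Y) U :=
  ThirdOrderODE.contDiffOn_pbar hU h.smooth_X h.smooth_Y h.deriv_X_ne

theorem contDiffOn_qbar (h : IsFPEquiv F U F' U' X Y) (hU : IsOpen U) :
    ContDiffOn ℝ ∞ (qbar X Y) U :=
  ThirdOrderODE.contDiffOn_qbar hU h.smooth_X h.smooth_Y h.deriv_X_ne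

theorem pd_two_pbar (h : IsFPEquiv F U F' U' X Y) (hU : IsOpen U) {z : Jet} (hz : z ∈ U) :
    pd 2 (pbar X Y) z = pd 1 (ybar Y) z / deriv X (z 0) :=
  ThirdOrderODE.pd_two_pbar (differentiableAt_of_contDiffOn hU (h.contDiffOn_pbar hU) hz)

theorem pd_two_pbar_ne (h : IsFPEquiv F U F' U' X Y) (hU : IsOpen U) {z : Jet} (hz : z ∈ U) :
    pd 2 (pbar X Y) z ≠ 0 := by
  rw [h.pd_two_pbar hU hz]
  exact div_ne_zero (h.deriv_Y_ne z hz) (h.deriv_X_ne z hz)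

theorem pd_three_qbar_ne (h : IsFPEquiv F U F' U' X Y) (hU : IsOpen U) {z : Jet} (hz : z ∈ U) :
    pd 3 (qbar X Y) z ≠ 0 := by
  rw [pd_three_qbar (differentiableAt_of_contDiffOn hU (h.contDiffOn_qbar hU) hz)]
  exact div_ne_zero (h.pd_two_pbar_ne hU hz) (h.deriv_X_ne z hz)

theorem contDiffOn_lift (h : IsFPEquiv F U F' U' X Y) (hU : IsOpen U) :
    ContDiffOn ℝ ∞ (lift X Y) (P U) := by
  have hYy := contDiffOn_comp_jet (contDiffOn_pd hU (contDiffOn_ybar h.smooth_Y) 1)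
  have hY0 : ∀ u ∈ P U, pd 1 (ybar Y) (jet u) ≠ 0 := fun u hu => h.deriv_Y_ne _ hu.1
  rw [contDiffOn_pi]
  intro i
  fin_cases i
  · exact contDiffOn_comp_jet (contDiffOn_comp_projX h.smooth_X)
  · exact contDiffOn_comp_jet (contDiffOn_ybar h.smooth_Y)
  · exact contDiffOn_comp_jet (h.contDiffOn_pbar hU)
  · exact contDiffOn_comp_jet (h.contDiffOn_qbar hU)
  · exact (contDiff_coord 4).contDiffOn.div hYy hY0
  · exact ((contDiff_coord 5).contDiffOn.div
      (contDiffOn_comp_jet (contDiffOn_deriv_X hU h.smooth_X)) fun _ hu => h.deriv_X_ne' hu).sub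
      ((contDiffOn_comp_jet (contDiffOn_pd hU (h.contDiffOn_pbar hU) 1)).div hYy hY0)

theorem mapsTo_lift (h : IsFPEquiv F U F' U' X Y) : MapsTo (lift X Y) (P U) (P U') := by
  intro u hu
  refine ⟨?_, div_ne_zero hu.2 (h.deriv_Y_ne _ hu.1)⟩
  rw [jet_lift, ← h.image_eq]
  exact mem_image_of_mem _ hu.1

theorem contDiffAt_lift (h : IsFPEquiv F U F' U' X Y) (hU : IsOpen U) {u : Six} (hu : u ∈ P U) :
    ContDiffAt ℝ ∞ (lift X Y) u :=
  (h.contDiffOn_lift hU).contDiffAt ((isOpen_P hU).mem_nhds hu)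

theorem om_comp_fderiv (h : IsFPEquiv F U F' U' X Y) (hU : IsOpen U) {u : Six} (hu : u ∈ P U)
    {ψ : Six → Six} (hψ : DifferentiableAt ℝ ψ u)
    (hc : ∀ u ∈ P U, jet (ψ u) = prolong X Y (jet u)) :
    om4.comp (fderiv ℝ ψ u) = deriv X (u 0) • om4 ∧
    (om1 (ψ u)).comp (fderiv ℝ ψ u) = pd 1 (ybar Y) (jet u) • om1 u ∧
    (om2 (ψ u)).comp (fderiv ℝ ψ u) =
      pd 1 (pbar X Y) (jet u) • om1 u + pd 2 (pbar X Y) (jet u) • om2 u ∧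
    (om3 F' (ψ u)).comp (fderiv ℝ ψ u) = pd 1 (qbar X Y) (jet u) • om1 u
      + pd 2 (qbar X Y) (jet u) • om2 u + pd 3 (qbar X Y) (jet u) • om3 F u :=
  comp_fderiv_of_covers hU h.smooth_X h.smooth_Y h.deriv_X_ne h.transforms hu.1 hψ
    (by filter_upwards [(isOpen_P hU).mem_nhds hu] with x hx using hc x hx)

/-- The lift sends α to α/ȳ_y, which makes θ¹ pull back to αω¹, and its γ-component makes γ the
ratio of the ω¹ and ω² coefficients in the pullback of θ². The remaining coefficients are the
parameters of `pullbackReduction`. -/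
theorem th_comp_fderiv_lift (h : IsFPEquiv F U F' U' X Y) (hU : IsOpen U) {u : Six}
    (hu : u ∈ P U) :
    (Reduction.th1 (lift X Y u)).comp (fderiv ℝ (lift X Y) u) = Reduction.th1 u ∧
    ((canonical F').th2 (lift X Y u)).comp (fderiv ℝ (lift X Y) u)
      = (pullbackReduction X Y F').th2 u ∧
    ((canonical F').th3 F' (lift X Y u)).comp (fderiv ℝ (lift X Y) u)
      = (pullbackReduction X Y F').th3 F u ∧
    ((canonical F').th4 (lift X Y u)).comp (fderiv ℝ (lift X Y) u)
      = (pullbackReduction X Y F').th4 u := by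
  obtain ⟨o4, o1, o2, o3⟩ := h.om_comp_fderiv hU hu
    ((h.contDiffAt_lift hU hu).differentiableAt (by simp)) fun u _ => jet_lift X Y u
  have hY0 := h.deriv_Y_ne _ hu.1
  have hX0 := h.deriv_X_ne' hu
  have hq0 := h.pd_three_qbar_ne hU hu.1
  have e2 : pd 2 (pbar X Y) (jet u) = pd 1 (ybar Y) (jet u) / deriv X (u 0) :=
    h.pd_two_pbar hU hu.1
  refine ⟨?_, ?_, ?_, ?_⟩
  · rw [Reduction.th1, ContinuousLinearMap.smul_comp, o1, lift_four, smul_smul,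
      div_mul_cancel₀ _ hY0]
    rfl
  · rw [Reduction.th2, ContinuousLinearMap.smul_comp, ContinuousLinearMap.add_comp,
      ContinuousLinearMap.smul_comp, o1, o2, lift_five]
    ext v
    simp [Reduction.th2, pullbackReduction, e2]
    field_simp
    ring
  · rw [Reduction.th3, ContinuousLinearMap.smul_comp, ContinuousLinearMap.add_comp,
      ContinuousLinearMap.add_comp, ContinuousLinearMap.smul_comp,
      ContinuousLinearMap.smul_comp, o1, o2, o3]
    ext v
    simp [Reduction.th3, pullbackReduction]
    field_simp
    ring
  · rw [Reduction.th4, ContinuousLinearMap.smul_comp, o4, smul_smul]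
    rfl

/-- The structure equations of F' are pulled back by the lift: d and ∧ are natural, and a, b, c, e,
f are composed with it. -/
theorem isNormalized_pullbackReduction (h : IsFPEquiv F U F' U' X Y) (hU : IsOpen U)
    (hU' : IsOpen U') (hF' : ContDiffOn ℝ ∞ F' U') (hFqq' : ∀ z ∈ U', pd 3 (pd 3 F') z ≠ 0) :
    (pullbackReduction X Y F').IsNormalized F U := by
  have hN := isNormalized_canonical hU' hF' hFqq'
  have hm := h.mapsTo_lift
  have hl := h.contDiffOn_lift hU
  have hDl := hl.fderiv_of_isOpen (isOpen_P hU) (m := ∞) (by simp)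
  have hp := h.contDiffOn_pbar hU
  have hq := h.contDiffOn_qbar hU
  have hX' := contDiffOn_comp_jet (contDiffOn_deriv_X hU h.smooth_X)
  have p1 := contDiffOn_comp_jet (contDiffOn_pd hU hp 1)
  have p2 := contDiffOn_comp_jet (contDiffOn_pd hU hp 2)
  have q1 := contDiffOn_comp_jet (contDiffOn_pd hU hq 1)
  have q2 := contDiffOn_comp_jet (contDiffOn_pd hU hq 2)
  have q3 := contDiffOn_comp_jet (contDiffOn_pd hU hq 3)
  have y1 := contDiffOn_comp_jet (contDiffOn_pd hU (contDiffOn_ybar h.smooth_Y) 1)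
  have hq0 : ∀ u ∈ P U, pd 3 (qbar X Y) (jet u) ≠ 0 := fun u hu => h.pd_three_qbar_ne hU hu.1
  obtain ⟨a, b, c, e, f, hS⟩ := hN.structure_eqs
  refine ⟨(hN.smooth_β.comp hl hm).mul p2, (hN.smooth_ε.comp hl hm).mul q3,
    (q2.add ((hN.smooth_η.comp hl hm).mul p2)).div q3 hq0,
    ((q1.add ((hN.smooth_η.comp hl hm).mul p1)).add ((hN.smooth_κ.comp hl hm).mul y1)).div q3 hq0,
    (hN.smooth_lam.comp hl hm).mul hX', (hN.smooth_Om1.comp hl hm).clm_comp hDl,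
    (hN.smooth_Om2.comp hl hm).clm_comp hDl, fun u hu => ?_, ?_⟩
  · obtain ⟨h1, h2, h3⟩ := hN.ne_zero _ (hm hu)
    exact ⟨mul_ne_zero h1 (h.pd_two_pbar_ne hU hu.1), mul_ne_zero h2 (hq0 u hu),
      mul_ne_zero h3 (h.deriv_X_ne' hu)⟩
  · refine ⟨a ∘ lift X Y, b ∘ lift X Y, c ∘ lift X Y, e ∘ lift X Y, f ∘ lift X Y,
      fun u hu v w => ?_⟩
    have hd : ∀ i, DifferentiableAt ℝ (fun u => coframe F' u i) (lift X Y u) := fun i =>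
      ((contDiffOn_coframe hU' hF' hFqq' i).contDiffAt
        ((isOpen_P hU').mem_nhds (hm hu))).differentiableAt (by simp)
    have hc := h.contDiffAt_lift hU hu
    obtain ⟨t1, t2, t3, t4⟩ := h.th_comp_fderiv_lift hU hu
    have ev := (isOpen_P hU).mem_nhds hu
    have x1 : Reduction.th1 =ᶠ[𝓝 u]
        fun u => (Reduction.th1 (lift X Y u)).comp (fderiv ℝ (lift X Y) u) := by
      filter_upwards [ev] with x hx using (h.th_comp_fderiv_lift hU hx).1.symm
    have x2 : (pullbackReduction X Y F').th2 =ᶠ[𝓝 u]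
        fun u => ((canonical F').th2 (lift X Y u)).comp (fderiv ℝ (lift X Y) u) := by
      filter_upwards [ev] with x hx using (h.th_comp_fderiv_lift hU hx).2.1.symm
    have x3 : (pullbackReduction X Y F').th3 F =ᶠ[𝓝 u]
        fun u => ((canonical F').th3 F' (lift X Y u)).comp (fderiv ℝ (lift X Y) u) := by
      filter_upwards [ev] with x hx using (h.th_comp_fderiv_lift hU hx).2.2.1.symm
    have x4 : (pullbackReduction X Y F').th4 =ᶠ[𝓝 u]
        fun u => ((canonical F').th4 (lift X Y u)).comp (fderiv ℝ (lift X Y) u) := by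
      filter_upwards [ev] with x hx using (h.th_comp_fderiv_lift hU hx).2.2.2.symm
    have h0 := hS _ (hm hu) (fderiv ℝ (lift X Y) u v) (fderiv ℝ (lift X Y) u w)
    rw [extD_congr x1, extD_congr x2, extD_congr x3, extD_congr x4,
      extD_pullback (σ := Reduction.th1) (hd 0) hc v w,
      extD_pullback (σ := (canonical F').th2) (hd 1) hc v w,
      extD_pullback (σ := (canonical F').th3 F') (hd 2) hc v w,
      extD_pullback (σ := (canonical F').th4) (hd 3) hc v w, ← t1, ← t2, ← t3, ← t4]
    exact h0

/-- The lift of a fiber-preserving equivalence preserves the coframes. -/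
theorem coframe_comp_fderiv_lift (h : IsFPEquiv F U F' U' X Y) (hU : IsOpen U)
    (hF : ContDiffOn ℝ ∞ F U) (hFqq : ∀ z ∈ U, pd 3 (pd 3 F) z ≠ 0)
    (hU' : IsOpen U') (hF' : ContDiffOn ℝ ∞ F' U') (hFqq' : ∀ z ∈ U', pd 3 (pd 3 F') z ≠ 0)
    {u : Six} (hu : u ∈ P U) (i : Fin 6) :
    (coframe F' (lift X Y u) i).comp (fderiv ℝ (lift X Y) u) = coframe F u i := by
  -- Uniqueness replaces any explicit transformation formula for K, Ω¹ or Ω².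
  obtain ⟨e1, e2, e3, e4, e5, e6, e7⟩ :=
    (h.isNormalized_pullbackReduction hU hU' hF' hFqq').eq_canonical hU hF hFqq hu
  obtain ⟨t1, t2, t3, t4⟩ := h.th_comp_fderiv_lift hU hu
  fin_cases i
  · exact t1
  · exact t2.trans (by simp only [Reduction.th2, e1]; rfl)
  · exact t3.trans (by simp only [Reduction.th3, e2, e3, e4]; rfl)
  · exact t4.trans (by simp only [Reduction.th4, e5]; rfl)
  · exact e6
  · exact e7

end IsFPEquiv

end Lift

/-! ### The lift is a diffeomorphism and is unique. -/

/-- An injective smooth map with invertible derivatives on an open set is a diffeomorphism onto its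
open image. -/
theorem exists_openPartialHomeomorph {E : Type*} [NormedAddCommGroup E] [NormedSpace ℝ E]
    [FiniteDimensional ℝ E] {ψ : E → E} {S T : Set E} (hS : IsOpen S) (hψ : ContDiffOn ℝ ∞ ψ S)
    (hinj : InjOn ψ S) (himg : ψ '' S = T) (hd : ∀ u ∈ S, ∀ v, fderiv ℝ ψ u v = 0 → v = 0) :
    ∃ e : OpenPartialHomeomorph E E, e.source = S ∧ e.target = T ∧ ⇑e = ψ ∧
      ContDiffOn ℝ ∞ e.symm e.target := by
  have : CompleteSpace E := FiniteDimensional.complete ℝ E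
  have hc : ∀ u ∈ S, ContDiffAt ℝ ∞ ψ u := fun u hu => hψ.contDiffAt (hS.mem_nhds hu)
  have hequiv : ∀ u ∈ S, ∃ L : E ≃L[ℝ] E, (L : E →L[ℝ] E) = fderiv ℝ ψ u := by
    intro u hu
    have hi : Function.Injective (fderiv ℝ ψ u : E →ₗ[ℝ] E) := by
      rw [injective_iff_map_eq_zero]
      exact hd u hu
    exact ⟨(LinearEquiv.ofInjectiveEndo _ hi).toContinuousLinearEquiv, by ext v; rfl⟩
  choose! L hL using hequiv
  have hs : ∀ u ∈ S, HasStrictFDerivAt ψ (L u : E →L[ℝ] E) u := fun u hu => by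
    rw [hL u hu]
    exact (hc u hu).hasStrictFDerivAt (by simp)
  -- By the inverse function theorem ψ maps neighbourhoods onto neighbourhoods; with injectivity
  -- this makes the inverse continuous.
  have hopen : IsOpenMap (S.domRestrict ψ) := by
    rw [isOpenMap_iff_nhds_le]
    rintro ⟨u, hu⟩
    have h1 := (hs u hu).map_nhds_eq_of_equiv
    have h2 : Filter.map (S.domRestrict ψ) (𝓝 ⟨u, hu⟩) = Filter.map ψ (𝓝 u) := by
      rw [← hS.nhdsWithin_eq hu, ← map_nhds_subtype_val ⟨u, hu⟩, Filter.map_map]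
      rfl
    rw [h2, h1]
    rfl
  let p : PartialEquiv E E := (hinj.bijOn_image).toPartialEquiv ψ S (ψ '' S)
  let e := OpenPartialHomeomorph.ofContinuousOpenRestrict p hψ.continuousOn hopen hS
  refine ⟨e, rfl, himg, rfl, fun y hy => ?_⟩
  have hx : e.symm y ∈ S := e.map_target hy
  exact (e.contDiffAt_symm hy (hs _ hx).hasFDerivAt (hc _ hx)).contDiffWithinAt

section Lift

variable {X : ℝ → ℝ} {Y : ℝ × ℝ → ℝ} {F F' : Jet → ℝ} {U U' : Set Jet}

namespace IsFPEquiv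

/-- Over a fixed (x, y), p̄ is affine in p with slope ȳ_y/X' ≠ 0; over a fixed (x, y, p), q̄ is
affine in q with slope p̄_p/X' ≠ 0. -/
theorem injOn_prolong (h : IsFPEquiv F U F' U' X Y) (hU : IsOpen U) :
    InjOn (prolong X Y) U := by
  intro z hz w hw hzw
  have e0 : X (z 0) = X (w 0) := congrFun hzw 0
  have e1 : ybar Y z = ybar Y w := congrFun hzw 1
  have e2 : pbar X Y z = pbar X Y w := congrFun hzw 2
  have e3 : qbar X Y z = qbar X Y w := congrFun hzw 3
  have h01 : (z 0, z 1) = (w 0, w 1) :=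
    h.inj_XY ⟨z, hz, rfl⟩ ⟨w, hw, rfl⟩ (Prod.ext e0 e1)
  obtain ⟨h0, h1⟩ := Prod.ext_iff.1 h01
  dsimp only at h0 h1
  have hX0 := h.deriv_X_ne w hw
  have hY0 := h.deriv_Y_ne w hw
  have hzw' : z = (w + Pi.single 2 (z 2 - w 2)) + Pi.single 3 (z 3 - w 3) := by
    ext i
    fin_cases i <;> simp [h0, h1]
  have hy : ∀ i, pd i (ybar Y) z = pd i (ybar Y) w := fun i => by
    rw [hzw', (indep_three_ybar Y).pd i, (indep_two_ybar Y).pd i]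
  have h2 : z 2 = w 2 := by
    simp only [pbar, hy, h0] at e2
    field_simp at e2
    exact mul_right_cancel₀ hY0 (by linear_combination e2)
  have hzw'' : z = w + Pi.single 3 (z 3 - w 3) := by
    ext i
    fin_cases i <;> simp [h0, h1, h2]
  have hp : ∀ i, pd i (pbar X Y) z = pd i (pbar X Y) w := fun i => by
    rw [hzw'', (indep_three_pbar X Y).pd i]
  have hp0 := h.pd_two_pbar_ne hU hw
  have h3 : z 3 = w 3 := by
    simp only [qbar, hp, h0, h2] at e3
    field_simp at e3
    exact mul_right_cancel₀ hp0 (by linear_combination e3)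
  ext i
  fin_cases i
  exacts [h0, h1, h2, h3]

theorem injOn_lift (h : IsFPEquiv F U F' U' X Y) (hU : IsOpen U) :
    InjOn (lift X Y) (P U) := by
  intro u hu v hv huv
  have hj : jet u = jet v := by
    refine h.injOn_prolong hU hu.1 hv.1 ?_
    rw [← jet_lift, ← jet_lift, huv]
  have h0 : u 0 = v 0 := congrFun hj 0
  have e4 := congrFun huv 4
  have e5 := congrFun huv 5
  rw [lift_four, lift_four, hj] at e4
  rw [lift_five, lift_five, hj, h0] at e5
  have hX0 := h.deriv_X_ne' hv
  have hY0 := h.deriv_Y_ne _ hv.1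
  ext i
  fin_cases i
  · exact h0
  · exact congrFun hj 1
  · exact congrFun hj 2
  · exact congrFun hj 3
  · exact (div_left_inj' hY0).1 e4
  · exact (div_left_inj' hX0).1 (sub_left_injective e5)

theorem image_lift (h : IsFPEquiv F U F' U' X Y) : lift X Y '' P U = P U' := by
  refine (h.mapsTo_lift.image_subset).antisymm fun w hw => ?_
  obtain ⟨z, hz, hzw⟩ : jet w ∈ prolong X Y '' U := h.image_eq ▸ hw.1
  have hX0 := h.deriv_X_ne z hz
  have hY0 := h.deriv_Y_ne z hz
  have hw4 := hw.2
  -- The last two entries solve the fiber equations of the lift for α and γ.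
  let u : Six := ![z 0, z 1, z 2, z 3, w 4 * pd 1 (ybar Y) z,
    (w 5 + pd 1 (pbar X Y) z / pd 1 (ybar Y) z) * deriv X (z 0)]
  have hj : jet u = z := by
    ext i
    fin_cases i <;> rfl
  refine ⟨u, ⟨by rwa [hj], mul_ne_zero hw4 hY0⟩, ?_⟩
  have hj' : jet (lift X Y u) = jet w := by rw [jet_lift, hj, hzw]
  ext i
  fin_cases i
  · exact congrFun hj' 0
  · exact congrFun hj' 1
  · exact congrFun hj' 2
  · exact congrFun hj' 3
  · change lift X Y u 4 = w 4
    rw [lift_four, hj]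
    exact mul_div_cancel_right₀ _ hY0
  · change lift X Y u 5 = w 5
    rw [lift_five, hj]
    change (w 5 + pd 1 (pbar X Y) z / pd 1 (ybar Y) z) * deriv X (z 0) / deriv X (z 0) - _ = _
    field_simp
    ring

/-- The lift of a fiber-preserving equivalence is an isomorphism of coframes. -/
theorem exists_isCoframeIso (h : IsFPEquiv F U F' U' X Y) (hU : IsOpen U)
    (hF : ContDiffOn ℝ ∞ F U) (hFqq : ∀ z ∈ U, pd 3 (pd 3 F) z ≠ 0) (hU' : IsOpen U')
    (hF' : ContDiffOn ℝ ∞ F' U') (hFqq' : ∀ z ∈ U', pd 3 (pd 3 F') z ≠ 0) :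
    ∃ ψ : OpenPartialHomeomorph Six Six, ψ.source = P U ∧ ψ.target = P U' ∧
      IsCoframeIso F F' ψ ∧ ∀ u ∈ P U, jet (ψ u) = prolong X Y (jet u) := by
  have hc := fun u (hu : u ∈ P U) i =>
    h.coframe_comp_fderiv_lift hU hF hFqq hU' hF' hFqq' hu i
  -- The derivative of the lift is injective: a vector it kills is annihilated by the pulled back
  -- coframe, which is the coframe of F.
  obtain ⟨ψ, h1, h2, h3, h4⟩ := exists_openPartialHomeomorph (isOpen_P hU) (h.contDiffOn_lift hU)
    (h.injOn_lift hU) h.image_lift fun u hu v hv =>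
      coframe_injective (F := F) hu.2 (hFqq _ hu.1) fun i => by
        rw [← hc u hu i]
        simp [hv]
  refine ⟨ψ, h1, h2, ⟨by rw [h1, h3]; exact h.contDiffOn_lift hU, h4, ?_⟩, ?_⟩
  · rw [h1, h3]
    exact hc
  · rw [h3]
    exact fun u _ => jet_lift X Y u

/-- An isomorphism of coframes covering a prolongation is its lift. -/
theorem eq_lift (h : IsFPEquiv F U F' U' X Y) (hU : IsOpen U)
    (hFqq : ∀ z ∈ U, pd 3 (pd 3 F) z ≠ 0) {φ : OpenPartialHomeomorph Six Six}
    (hs : φ.source = P U) (hφ : IsCoframeIso F F' φ)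
    (hj : ∀ u ∈ P U, jet (φ u) = prolong X Y (jet u)) {u : Six} (hu : u ∈ P U) :
    φ u = lift X Y u := by
  have hus : u ∈ φ.source := hs ▸ hu
  have hd : DifferentiableAt ℝ φ u :=
    (hφ.smooth.contDiffAt (φ.open_source.mem_nhds hus)).differentiableAt (by simp)
  obtain ⟨-, o1, o2, -⟩ := h.om_comp_fderiv hU hu hd hj
  have hX0 := h.deriv_X_ne' hu
  have hY0 := h.deriv_Y_ne _ hu.1
  have t1 : (φ u 4 • om1 (φ u)).comp (fderiv ℝ φ u) = u 4 • om1 u := hφ.pullback u hus 0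
  have t2 : ((1 / 6 * pd 3 (pd 3 F') (jet (φ u))) • (om2 (φ u) + φ u 5 • om1 (φ u))).comp
      (fderiv ℝ φ u) = (1 / 6 * pd 3 (pd 3 F) (jet u)) • (om2 u + u 5 • om1 u) :=
    hφ.pullback u hus 1
  rw [ContinuousLinearMap.smul_comp, o1] at t1
  rw [ContinuousLinearMap.smul_comp, ContinuousLinearMap.add_comp, ContinuousLinearMap.smul_comp,
    o1, o2] at t2
  -- The ω¹ coefficient of θ¹ determines the new α, and the two coefficients of θ² determine the new
  -- γ.
  have a1 := congrArg (fun σ : Covec => σ (frame F u 1)) t1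
  have b1 := congrArg (fun σ : Covec => σ (frame F u 1)) t2
  have b2 := congrArg (fun σ : Covec => σ (frame F u 2)) t2
  simp only [add_apply, smul_apply, smul_eq_mul, om1_frame, om2_frame] at a1 b1 b2
  have e2 : pd 2 (pbar X Y) (jet u) = pd 1 (ybar Y) (jet u) / deriv X (u 0) :=
    h.pd_two_pbar hU hu.1
  have hG := hFqq _ hu.1
  have hp := h.pd_two_pbar_ne hU hu.1
  simp at a1 b1 b2
  have v4 : φ u 4 = lift X Y u 4 := by
    rw [lift_four, eq_div_iff hY0, a1]
  have v5 : φ u 5 = lift X Y u 5 := by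
    -- Were this zero, the ω² coefficient of the pulled back θ² would vanish, contrary to F_qq ≠ 0.
    have hG' : pd 3 (pd 3 F') (jet (φ u)) ≠ 0 := by
      intro h0
      rw [h0] at b2
      simp at b2
      exact hG b2
    have h1 : pd 1 (pbar X Y) (jet u) + φ u 5 * pd 1 (ybar Y) (jet u)
        = u 5 * pd 2 (pbar X Y) (jet u) := by
      apply mul_left_cancel₀ hG'
      linear_combination 6 * b1 - 6 * u 5 * b2
    rw [lift_five]
    rw [e2] at h1
    field_simp at h1 ⊢
    linear_combination h1
  have hj' := hj u hu
  ext i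
  fin_cases i
  · exact congrFun hj' 0
  · exact congrFun hj' 1
  · exact congrFun hj' 2
  · exact congrFun hj' 3
  · exact v4
  · exact v5

end IsFPEquiv

end Lift

/-! ### Recovering the transformation from a coframe isomorphism. -/

theorem eq_of_fderiv_apply_eq_zero {f : Six → ℝ} {B : Set Six} (hB : Convex ℝ B)
    (hf : ∀ x ∈ B, DifferentiableAt ℝ f x) {u u' : Six} (hu : u ∈ B) (hu' : u' ∈ B)
    (h : ∀ x ∈ B, fderiv ℝ f x (u' - u) = 0) : f u' = f u := by
  -- Restrict f to the segment from u to u'; only the derivative in its direction matters, so the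
  -- lemma applies within slices.
  have hl : ∀ t : ℝ, HasDerivAt (fun t : ℝ => u + t • (u' - u)) (u' - u) t := fun t => by
    simpa using ((hasDerivAt_id t).smul_const (u' - u)).const_add u
  have hm : ∀ t ∈ Icc (0 : ℝ) 1, u + t • (u' - u) ∈ B := fun t ht =>
    hB.add_smul_sub_mem hu hu' ht
  have hd : ∀ t ∈ Icc (0 : ℝ) 1, HasDerivAt (fun t : ℝ => f (u + t • (u' - u))) 0 t := by
    intro t ht
    have h1 := (hf _ (hm t ht)).hasFDerivAt.comp_hasDerivAt t (hl t)
    rwa [h _ (hm t ht)] at h1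
  have h1 := constant_of_has_deriv_right_zero
    (fun t ht => (hd t ht).continuousAt.continuousWithinAt)
    (fun t ht => (hd t (Ico_subset_Icc_self ht)).hasDerivWithinAt) 1 (by simp)
  simpa using h1

theorem eqOn_of_locally_constant {f : Six → ℝ} {S : Set Six} (hS : IsPreconnected S)
    (h : ∀ u ∈ S, ∃ r > 0, ∀ u' ∈ Metric.ball u r, u' ∈ S → f u' = f u) {u u' : Six}
    (hu : u ∈ S) (hu' : u' ∈ S) : f u = f u' := by
  have : PreconnectedSpace S := isPreconnected_iff_preconnectedSpace.1 hS
  have hl : IsLocallyConstant (fun u : S => f u) := by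
    rw [IsLocallyConstant.iff_eventually_eq]
    rintro ⟨u, hu⟩
    obtain ⟨r, hr, hf⟩ := h u hu
    have h1 : ∀ᶠ v : S in 𝓝 ⟨u, hu⟩, (v : Six) ∈ Metric.ball u r :=
      continuous_subtype_val.continuousAt.eventually (Metric.ball_mem_nhds u hr)
    exact h1.mono fun v hv => hf v hv v.2
  exact hl.apply_eq_of_preconnectedSpace ⟨u, hu⟩ ⟨u', hu'⟩

section Converse

variable {F F' : Jet → ℝ} {U U' : Set Jet} {ψ : OpenPartialHomeomorph Six Six}

namespace IsCoframeIso

theorem differentiableAt (hψ : IsCoframeIso F F' ψ) {u : Six} (hu : u ∈ ψ.source) :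
    DifferentiableAt ℝ ψ u :=
  (hψ.smooth.contDiffAt (ψ.open_source.mem_nhds hu)).differentiableAt (by simp)

theorem hasFDerivAt_coord (hψ : IsCoframeIso F F' ψ) {u : Six} (hu : u ∈ ψ.source) (i : Fin 6) :
    HasFDerivAt (fun u => ψ u i) ((dc i).comp (fderiv ℝ ψ u)) u :=
  (dc i).hasFDerivAt.comp u (hψ.differentiableAt hu).hasFDerivAt

/-- Both θ⁴ and its counterpart are nonvanishing multiples of dx, so the pullback of dx̄ is
proportional to dx. -/
theorem fderiv_zero (hψ : IsCoframeIso F F' ψ) (hFqq' : ∀ z ∈ U', pd 3 (pd 3 F') z ≠ 0)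
    (ht : ψ.target ⊆ P U') {u : Six} (hu : u ∈ ψ.source) {v : Six} (hv : v 0 = 0) :
    fderiv ℝ ψ u v 0 = 0 := by
  have h := congrArg (fun σ : Covec => σ v) (hψ.pullback u hu 3)
  have hm := ht (ψ.map_source hu)
  simpa [coframe, Reduction.forms, Reduction.th4, canonical, om4, hv, hFqq' _ hm.1, hm.2] using h

/-- On vectors with dx = dy = 0 the form θ¹ vanishes; as dx̄ vanishes too, preservation of θ¹ leaves
dȳ = 0. -/
theorem fderiv_one (hψ : IsCoframeIso F F' ψ) (hFqq' : ∀ z ∈ U', pd 3 (pd 3 F') z ≠ 0)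
    (ht : ψ.target ⊆ P U') {u : Six} (hu : u ∈ ψ.source) {v : Six} (hv : v 0 = 0)
    (hv' : v 1 = 0) : fderiv ℝ ψ u v 1 = 0 := by
  have h := congrArg (fun σ : Covec => σ v) (hψ.pullback u hu 0)
  have hm := ht (ψ.map_source hu)
  simpa [coframe, Reduction.forms, Reduction.th1, om1, hv, hv', hm.2,
    hψ.fderiv_zero hFqq' ht hu hv] using h

/-- On a connected slice `x = s`, the new independent variable is constant. -/
theorem apply_zero_eq (hψ : IsCoframeIso F F' ψ) (hFqq' : ∀ z ∈ U', pd 3 (pd 3 F') z ≠ 0)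
    (ht : ψ.target ⊆ P U') {W : Set Six} (hW : W ⊆ ψ.source) {s : ℝ}
    (hc : IsPreconnected {u | u ∈ W ∧ u 0 = s}) {u u' : Six} (hu : u ∈ W) (hu' : u' ∈ W)
    (h : u 0 = s) (h' : u' 0 = s) : ψ u 0 = ψ u' 0 := by
  refine eqOn_of_locally_constant (f := fun u => ψ u 0) hc (fun w hw => ?_) ⟨hu, h⟩ ⟨hu', h'⟩
  -- The ball need only lie in the source of ψ, not in W: the segment joining two slice points stays
  -- in the ball and has dx = 0.
  obtain ⟨r, hr, hb⟩ := Metric.isOpen_iff.1 ψ.open_source w (hW hw.1)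
  refine ⟨r, hr, fun w' hwr hw' => ?_⟩
  refine eq_of_fderiv_apply_eq_zero (convex_ball w r)
    (fun x hx => (hψ.hasFDerivAt_coord (hb hx) 0).differentiableAt)
    (Metric.mem_ball_self hr) hwr fun x hx => ?_
  rw [(hψ.hasFDerivAt_coord (hb hx) 0).fderiv]
  exact hψ.fderiv_zero hFqq' ht (hb hx) (by simp [hw.2, hw'.2])

/-- On a connected slice `x = s, y = t`, the new dependent variable is constant. -/
theorem apply_one_eq (hψ : IsCoframeIso F F' ψ) (hFqq' : ∀ z ∈ U', pd 3 (pd 3 F') z ≠ 0)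
    (ht : ψ.target ⊆ P U') {W : Set Six} (hW : W ⊆ ψ.source) {s t : ℝ}
    (hc : IsPreconnected {u | u ∈ W ∧ u 0 = s ∧ u 1 = t}) {u u' : Six} (hu : u ∈ W)
    (hu' : u' ∈ W) (h : u 0 = s ∧ u 1 = t) (h' : u' 0 = s ∧ u' 1 = t) : ψ u 1 = ψ u' 1 := by
  refine eqOn_of_locally_constant (f := fun u => ψ u 1) hc (fun w hw => ?_) ⟨hu, h⟩ ⟨hu', h'⟩
  obtain ⟨r, hr, hb⟩ := Metric.isOpen_iff.1 ψ.open_source w (hW hw.1)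
  refine ⟨r, hr, fun w' hwr hw' => ?_⟩
  refine eq_of_fderiv_apply_eq_zero (convex_ball w r)
    (fun x hx => (hψ.hasFDerivAt_coord (hb hx) 1).differentiableAt)
    (Metric.mem_ball_self hr) hwr fun x hx => ?_
  rw [(hψ.hasFDerivAt_coord (hb hx) 1).fderiv]
  exact hψ.fderiv_one hFqq' ht (hb hx) (by simp [hw.2, hw'.2]) (by simp [hw.2, hw'.2])

variable {X : ℝ → ℝ} {Y : ℝ × ℝ → ℝ} {W : Set Six}

theorem contDiffOn_X (hψ : IsCoframeIso F F' ψ) (hWo : IsOpen W) (hW : W ⊆ ψ.source)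
    (hX : ∀ u ∈ W, ψ u 0 = X (u 0)) : ContDiffOn ℝ ∞ X (baseX (jet '' W)) := by
  rintro s ⟨z, ⟨u, hu, rfl⟩, rfl⟩
  -- Near `u 0`, X is the first component of ψ along the x-line through u, hence smooth.
  let ι : ℝ → Six := fun x => ![x, u 1, u 2, u 3, u 4, u 5]
  have hι : ContDiff ℝ ∞ ι := by
    rw [contDiff_pi]
    intro i
    fin_cases i
    exacts [contDiff_id, contDiff_const, contDiff_const, contDiff_const, contDiff_const,
      contDiff_const]
  have hιu : ι (u 0) = u := by
    ext i
    fin_cases i <;> rfl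
  have h1 : ∀ᶠ x in 𝓝 (u 0), ι x ∈ W :=
    hι.continuous.continuousAt.eventually (by rw [hιu]; exact hWo.mem_nhds hu)
  have h2 : ContDiffAt ℝ ∞ (fun x => ψ (ι x) 0) (u 0) := by
    have h3 : ContDiffAt ℝ ∞ ψ (ι (u 0)) := by
      rw [hιu]
      exact hψ.smooth.contDiffAt (ψ.open_source.mem_nhds (hW hu))
    exact contDiffAt_pi.1 (h3.comp (u 0) hι.contDiffAt) 0
  refine (h2.congr_of_eventuallyEq ?_).contDiffWithinAt
  filter_upwards [h1] with x hx using (hX _ hx).symm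

theorem contDiffOn_Y (hψ : IsCoframeIso F F' ψ) (hWo : IsOpen W) (hW : W ⊆ ψ.source)
    (hY : ∀ u ∈ W, ψ u 1 = Y (u 0, u 1)) : ContDiffOn ℝ ∞ Y (baseXY (jet '' W)) := by
  rintro s ⟨z, ⟨u, hu, rfl⟩, rfl⟩
  let ι : ℝ × ℝ → Six := fun x => ![x.1, x.2, u 2, u 3, u 4, u 5]
  have hι : ContDiff ℝ ∞ ι := by
    rw [contDiff_pi]
    intro i
    fin_cases i
    exacts [contDiff_fst, contDiff_snd, contDiff_const, contDiff_const, contDiff_const,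
      contDiff_const]
  have hιu : ι (u 0, u 1) = u := by
    ext i
    fin_cases i <;> rfl
  have h1 : ∀ᶠ x in 𝓝 (u 0, u 1), ι x ∈ W :=
    hι.continuous.continuousAt.eventually (by rw [hιu]; exact hWo.mem_nhds hu)
  have h2 : ContDiffAt ℝ ∞ (fun x => ψ (ι x) 1) (u 0, u 1) := by
    have h3 : ContDiffAt ℝ ∞ ψ (ι (u 0, u 1)) := by
      rw [hιu]
      exact hψ.smooth.contDiffAt (ψ.open_source.mem_nhds (hW hu))
    exact contDiffAt_pi.1 (h3.comp (u 0, u 1) hι.contDiffAt) 1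
  refine (h2.congr_of_eventuallyEq ?_).contDiffWithinAt
  filter_upwards [h1] with x hx using (hY _ hx).symm

end IsCoframeIso

theorem isOpenMap_jet : IsOpenMap jet := by
  have h : jet = jetL := funext fun u => (jetL_apply u).symm
  rw [h]
  refine jetL.isOpenMap fun z => ⟨![z 0, z 1, z 2, z 3, 0, 0], ?_⟩
  rw [jetL_apply]
  ext i
  fin_cases i <;> rfl

end Converse

section Converse

variable {F F' : Jet → ℝ} {U U' : Set Jet} {ψ : OpenPartialHomeomorph Six Six} {X : ℝ → ℝ}
  {Y : ℝ × ℝ → ℝ} {W : Set Six}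

/-- An isomorphism of coframes whose first two components are `X` and `Y` covers the prolongation
of `(X, Y)`, which transforms the equations into each other. -/
theorem IsCoframeIso.covers_prolong (hψ : IsCoframeIso F F' ψ)
    (hFqq : ∀ z ∈ U, pd 3 (pd 3 F) z ≠ 0) (hFqq' : ∀ z ∈ U', pd 3 (pd 3 F') z ≠ 0)
    (ht : ψ.target ⊆ P U') (hWo : IsOpen W) (hW : W ⊆ ψ.source) (hWP : W ⊆ P U)
    (hX : ∀ u ∈ W, ψ u 0 = X (u 0)) (hY : ∀ u ∈ W, ψ u 1 = Y (u 0, u 1)) {u : Six} (hu : u ∈ W) :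
    deriv X (u 0) ≠ 0 ∧ pd 1 (ybar Y) (jet u) ≠ 0 ∧ jet (ψ u) = prolong X Y (jet u) ∧
      F' (prolong X Y (jet u)) = thirdbar F X Y (jet u) := by
  have hVo : IsOpen (jet '' W) := isOpenMap_jet W hWo
  have sX := hψ.contDiffOn_X hWo hW hX
  have sY := hψ.contDiffOn_Y hWo hW hY
  have hm : ∀ u ∈ W, ψ u ∈ P U' := fun u hu => ht (ψ.map_source (hW hu))
  have hj : ∀ u ∈ W, jet u ∈ jet '' W := fun u hu => mem_image_of_mem _ hu
  have ev : ∀ u ∈ W, ∀ᶠ u' in 𝓝 u, u' ∈ W := fun u hu => hWo.mem_nhds hu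
  have e0 : ∀ u ∈ W, (dc 0).comp (fderiv ℝ ψ u) = deriv X (u 0) • om4 := by
    intro u hu
    have dX : DifferentiableAt ℝ X (jet u 0) :=
      (sX.contDiffAt ((isOpen_baseX hVo).mem_nhds ⟨_, hj u hu, rfl⟩)).differentiableAt (by simp)
    rw [dc_comp_fderiv F (hψ.differentiableAt (hW hu)) (f := fun z : Jet => X (z 0))
      (differentiableAt_of_contDiffOn hVo (contDiffOn_comp_projX sX) (hj u hu))
      ((ev u hu).mono hX)]
    simp [dJet, tot, pd_comp_projX dX]
  have e1 : ∀ u ∈ W, (dc 1).comp (fderiv ℝ ψ u)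
      = tot F (ybar Y) (jet u) • om4 + pd 1 (ybar Y) (jet u) • om1 u := by
    intro u hu
    rw [dc_comp_fderiv F (hψ.differentiableAt (hW hu)) (f := ybar Y)
      (differentiableAt_of_contDiffOn hVo (contDiffOn_ybar sY) (hj u hu))
      ((ev u hu).mono hY)]
    simp [dJet, (indep_two_ybar Y).pd_eq_zero, (indep_three_ybar Y).pd_eq_zero]
  -- If X' vanished, the pullback of the new θ⁴ would kill the total derivative direction, on which
  -- θ⁴ is nonzero.
  have hX0 : ∀ u ∈ W, deriv X (u 0) ≠ 0 := by
    intro u hu h0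
    have h := congrArg (fun σ : Covec => σ (frame F u 0)) (hψ.pullback u (hW hu) 3)
    have h1 : fderiv ℝ ψ u (frame F u 0) 0 = 0 := by
      have := congrArg (fun σ : Covec => σ (frame F u 0)) (e0 u hu)
      simpa [h0] using this
    have hP := hWP hu
    have : om4 (fderiv ℝ ψ u (frame F u 0)) = 0 := h1
    simp [coframe, Reduction.forms, Reduction.th4, canonical, this] at h
    exact div_ne_zero (mul_ne_zero (by norm_num) hP.2) (hFqq _ hP.1) h.symm
  have t1 : ∀ u ∈ W, ψ u 4 • ((dc 1).comp (fderiv ℝ ψ u)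
      - ψ u 2 • (dc 0).comp (fderiv ℝ ψ u)) = u 4 • om1 u := fun u hu =>
    hψ.pullback u (hW hu) 0
  have hY0 : ∀ u ∈ W, pd 1 (ybar Y) (jet u) ≠ 0 := by
    intro u hu h0
    have h := congrArg (fun σ : Covec => σ (frame F u 1)) (t1 u hu)
    simp only [e0 u hu, e1 u hu] at h
    simp [h0] at h
    exact (hWP hu).2 h.symm
  -- θ¹ kills the total derivative direction, so Dȳ = ψ₂ · X', which says that ψ₂ is p̄.
  have c2 : ∀ u ∈ W, ψ u 2 = pbar X Y (jet u) := by
    intro u hu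
    have h := congrArg (fun σ : Covec => σ (frame F u 0)) (t1 u hu)
    have h0 : deriv X (jet u 0) ≠ 0 := hX0 u hu
    simp only [e0 u hu, e1 u hu, tot_ybar F h0] at h
    simp [(hm u hu).2] at h
    exact mul_left_cancel₀ (hX0 u hu) (by linear_combination -h)
  have hX0' : ∀ z ∈ jet '' W, deriv X (z 0) ≠ 0 := by
    rintro z ⟨u, hu, rfl⟩
    exact hX0 u hu
  have e2 : ∀ u ∈ W, (dc 2).comp (fderiv ℝ ψ u) = tot F (pbar X Y) (jet u) • om4
      + pd 1 (pbar X Y) (jet u) • om1 u + pd 2 (pbar X Y) (jet u) • om2 u := by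
    intro u hu
    rw [dc_comp_fderiv F (hψ.differentiableAt (hW hu)) (f := pbar X Y)
      (differentiableAt_of_contDiffOn hVo (contDiffOn_pbar hVo sX sY hX0') (hj u hu))
      ((ev u hu).mono c2)]
    simp [dJet, (indep_three_pbar X Y).pd_eq_zero]
  -- By triangularity of θ¹, θ², θ³, the new contact forms successively vanish on the image of the
  -- total derivative direction. The second gives q̄, and the third gives the transformation law for
  -- F.
  have o1 : ∀ u ∈ W, om1 (ψ u) (fderiv ℝ ψ u (frame F u 0)) = 0 := by
    intro u hu
    have h := congrArg (fun σ : Covec => σ (frame F u 0)) (hψ.pullback u (hW hu) 0)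
    simpa [coframe, Reduction.forms, Reduction.th1, (hm u hu).2] using h
  have o2 : ∀ u ∈ W, om2 (ψ u) (fderiv ℝ ψ u (frame F u 0)) = 0 := by
    intro u hu
    have h := congrArg (fun σ : Covec => σ (frame F u 0)) (hψ.pullback u (hW hu) 1)
    simpa [coframe, Reduction.forms, Reduction.th2, canonical, o1 u hu,
      hFqq' _ (hm u hu).1] using h
  have o3 : ∀ u ∈ W, om3 F' (ψ u) (fderiv ℝ ψ u (frame F u 0)) = 0 := by
    intro u hu
    have h := congrArg (fun σ : Covec => σ (frame F u 0)) (hψ.pullback u (hW hu) 2)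
    simpa [coframe, Reduction.forms, Reduction.th3, canonical, o1 u hu, o2 u hu,
      hFqq' _ (hm u hu).1, (hm u hu).2] using h
  have d0 : ∀ u ∈ W, fderiv ℝ ψ u (frame F u 0) 0 = deriv X (u 0) := fun u hu => by
    have h := congrArg (fun σ : Covec => σ (frame F u 0)) (e0 u hu)
    simpa using h
  have c3 : ∀ u ∈ W, ψ u 3 = qbar X Y (jet u) := by
    intro u hu
    have h0 : deriv X (jet u 0) ≠ 0 := hX0 u hu
    have h1 := congrArg (fun σ : Covec => σ (frame F u 0)) (e2 u hu)
    have h2 := o2 u hu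
    simp [tot_pbar F h0] at h1
    simp [om2, d0 u hu, h1] at h2
    exact mul_left_cancel₀ (hX0 u hu) (by linear_combination -h2)
  have cj : ∀ u ∈ W, jet (ψ u) = prolong X Y (jet u) := by
    intro u hu
    ext i
    fin_cases i
    exacts [hX u hu, hY u hu, c2 u hu, c3 u hu]
  refine ⟨hX0 u hu, hY0 u hu, cj u hu, ?_⟩
  have h0 : deriv X (jet u 0) ≠ 0 := hX0 u hu
  have e3 := dc_comp_fderiv F (hψ.differentiableAt (hW hu)) (f := qbar X Y)
    (differentiableAt_of_contDiffOn hVo (contDiffOn_qbar hVo sX sY hX0') (hj u hu))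
    ((ev u hu).mono c3)
  have h1 := congrArg (fun σ : Covec => σ (frame F u 0)) e3
  have h2 := o3 u hu
  simp [dJet, tot_qbar F h0] at h1
  simp [om3, d0 u hu, h1, cj u hu] at h2
  exact mul_left_cancel₀ (hX0 u hu) (by linear_combination -h2)

theorem injOn_of_deriv_ne_zero {f : ℝ → ℝ} {s : Set ℝ} (hs : s.OrdConnected)
    (hf : ∀ x ∈ s, DifferentiableAt ℝ f x) (hf' : ∀ x ∈ s, deriv f x ≠ 0) : InjOn f s := by
  have key : ∀ x ∈ s, ∀ y ∈ s, x < y → f x ≠ f y := by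
    intro x hx y hy hxy h
    have hI := hs.out hx hy
    obtain ⟨c, hc, hc'⟩ := exists_deriv_eq_zero hxy
      (fun t ht => (hf t (hI ht)).continuousAt.continuousWithinAt) h
    exact hf' c (hI (Ioo_subset_Icc_self hc)) hc'
  intro x hx y hy h
  rcases lt_trichotomy x y with h1 | h1 | h1
  · exact absurd h (key x hx y hy h1)
  · exact h1
  · exact absurd h.symm (key y hy x hx h1)

/-- An isomorphism of coframes induces a fiber-preserving equivalence, if the slices of its domain
are connected. -/
theorem IsCoframeIso.exists_isFPEquiv (hψ : IsCoframeIso F F' ψ)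
    (hFqq : ∀ z ∈ U, pd 3 (pd 3 F) z ≠ 0) (hFqq' : ∀ z ∈ U', pd 3 (pd 3 F') z ≠ 0)
    (ht : ψ.target ⊆ P U') (hWo : IsOpen W) (hW : W ⊆ ψ.source) (hWP : W ⊆ P U)
    (hc : IsPreconnected W) (hcx : ∀ s, IsPreconnected {u | u ∈ W ∧ u 0 = s})
    (hcxy : ∀ s t, IsPreconnected {u | u ∈ W ∧ u 0 = s ∧ u 1 = t}) :
    ∃ X Y, IsFPEquiv F (jet '' W) F' (jet '' (ψ '' W)) X Y ∧
      ∀ u ∈ W, jet (ψ u) = prolong X Y (jet u) := by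
  have hX : ∃ X : ℝ → ℝ, ∀ u ∈ W, ψ u 0 = X (u 0) := by
    classical
    -- Every point of the slice gives the same value. The value 0 off the open base set is
    -- immaterial, because only values and derivatives on that set are used.
    refine ⟨fun s => if h : ∃ u ∈ W, u 0 = s then ψ h.choose 0 else 0, fun u hu => ?_⟩
    have h : ∃ u' ∈ W, u' 0 = u 0 := ⟨u, hu, rfl⟩
    dsimp only
    rw [dif_pos h]
    exact hψ.apply_zero_eq hFqq' ht hW (hcx (u 0)) hu h.choose_spec.1 rfl h.choose_spec.2
  have hY : ∃ Y : ℝ × ℝ → ℝ, ∀ u ∈ W, ψ u 1 = Y (u 0, u 1) := by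
    classical
    refine ⟨fun s => if h : ∃ u ∈ W, u 0 = s.1 ∧ u 1 = s.2 then ψ h.choose 1 else 0,
      fun u hu => ?_⟩
    have h : ∃ u' ∈ W, u' 0 = (u 0, u 1).1 ∧ u' 1 = (u 0, u 1).2 := ⟨u, hu, rfl, rfl⟩
    dsimp only
    rw [dif_pos h]
    exact hψ.apply_one_eq hFqq' ht hW (hcxy (u 0) (u 1)) hu h.choose_spec.1 ⟨rfl, rfl⟩
      h.choose_spec.2
  obtain ⟨X, hX⟩ := hX
  obtain ⟨Y, hY⟩ := hY
  have hp := fun u (hu : u ∈ W) =>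
    hψ.covers_prolong (F := F) hFqq hFqq' ht hWo hW hWP hX hY hu
  have hVo : IsOpen (jet '' W) := isOpenMap_jet W hWo
  have sX := hψ.contDiffOn_X hWo hW hX
  have sY := hψ.contDiffOn_Y hWo hW hY
  -- The base is an interval because W is connected, so Rolle's theorem applies; for Y the connected
  -- slices x = s play this role.
  have iX : InjOn X (baseX (jet '' W)) := by
    have e : baseX (jet '' W) = (fun u : Six => u 0) '' W := by
      rw [baseX, image_image]
      rfl
    refine injOn_of_deriv_ne_zero ?_ (fun x hx => (sX.contDiffAt
      ((isOpen_baseX hVo).mem_nhds hx)).differentiableAt (by simp)) ?_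
    · rw [e]
      exact (hc.image _ (continuous_apply (0 : Fin 6)).continuousOn).ordConnected
    · rintro x ⟨z, ⟨u, hu, rfl⟩, rfl⟩
      exact (hp u hu).1
  have iY : ∀ s, InjOn (fun t => Y (s, t)) {t | (s, t) ∈ baseXY (jet '' W)} := by
    intro s
    have e : {t | (s, t) ∈ baseXY (jet '' W)} = (fun u : Six => u 1) '' {u | u ∈ W ∧ u 0 = s} := by
      ext t
      constructor
      · rintro ⟨z, ⟨u, hu, rfl⟩, h⟩
        exact ⟨u, ⟨hu, congrArg Prod.fst h⟩, congrArg Prod.snd h⟩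
      · rintro ⟨u, ⟨hu, rfl⟩, rfl⟩
        exact ⟨jet u, ⟨u, hu, rfl⟩, rfl⟩
    have hd : ∀ u ∈ W, HasDerivAt (fun t => Y (u 0, t)) (pd 1 (ybar Y) (jet u)) (u 1) := by
      intro u hu
      have h1 := hasDerivAt_line (differentiableAt_of_contDiffOn hVo (contDiffOn_ybar sY)
        (mem_image_of_mem jet hu)) 1
      -- The line derivative is taken at parameter 0; writing 0 as `u 1 - u 1` allows a translation
      -- to the point `u 1`.
      rw [← sub_self (u 1)] at h1
      have h2 := h1.comp_sub_const (u 1) (u 1)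
      simpa [ybar] using h2
    refine injOn_of_deriv_ne_zero ?_ ?_ ?_
    · rw [e]
      exact ((hcx s).image _ (continuous_apply (1 : Fin 6)).continuousOn).ordConnected
    · rintro t ⟨z, ⟨u, hu, rfl⟩, h⟩
      obtain ⟨rfl, rfl⟩ := Prod.ext_iff.1 h
      exact (hd u hu).differentiableAt
    · rintro t ⟨z, ⟨u, hu, rfl⟩, h⟩
      obtain ⟨rfl, rfl⟩ := Prod.ext_iff.1 h
      have h3 := (hd u hu).deriv
      simp only [jet_zero, jet_one]
      rw [h3]
      exact (hp u hu).2.1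
  refine ⟨X, Y, ⟨sX, sY, iX, ?_, ?_, ?_, ?_, ?_⟩, fun u hu => (hp u hu).2.2.1⟩
  -- Injectivity of X first gives equal x-coordinates; injectivity of Y on that slice then gives
  -- equal y-coordinates.
  · rintro ⟨s, t⟩ hst ⟨s', t'⟩ hst' h
    obtain ⟨h1, h2⟩ := Prod.ext_iff.1 h
    dsimp only at h1 h2
    have hb : ∀ {a b : ℝ}, (a, b) ∈ baseXY (jet '' W) → a ∈ baseX (jet '' W) := by
      rintro a b ⟨z, hz, h⟩
      exact ⟨z, hz, congrArg Prod.fst h⟩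
    obtain rfl := iX (hb hst) (hb hst') h1
    rw [iY s hst hst' h2]
  · rintro z ⟨u, hu, rfl⟩
    exact (hp u hu).1
  · rintro z ⟨u, hu, rfl⟩
    exact (hp u hu).2.1
  · rw [image_image, image_image]
    exact image_congr fun u hu => (hp u hu).2.2.1.symm
  · rintro z ⟨u, hu, rfl⟩
    exact (hp u hu).2.2.2

end Converse

/-! ### Local and global equivalence. -/

theorem P_mono {U V : Set Jet} (h : V ⊆ U) : P V ⊆ P U := fun _ hu => ⟨h hu.1, hu.2⟩

/-- The point over the jet `z` with `α = a` and `γ = c`. -/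
def pointOver (z : Jet) (a c : ℝ) : Six := ![z 0, z 1, z 2, z 3, a, c]

theorem jet_pointOver (z : Jet) (a c : ℝ) : jet (pointOver z a c) = z := by
  ext i
  fin_cases i <;> rfl

theorem pointOver_four (z : Jet) (a c : ℝ) : pointOver z a c 4 = a := rfl

theorem pointOver_jet (u : Six) : pointOver (jet u) (u 4) (u 5) = u := by
  ext i
  fin_cases i <;> rfl

/-- The set is the continuous image of the product of S, A and the γ-line. -/
theorem isPreconnected_over {S : Set Jet} {A : Set ℝ} (hS : IsPreconnected S)
    (hA : IsPreconnected A) : IsPreconnected {u : Six | jet u ∈ S ∧ u 4 ∈ A} := by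
  have hg : Continuous fun w : Jet × ℝ × ℝ => pointOver w.1 w.2.1 w.2.2 := by
    refine continuous_pi fun i => ?_
    fin_cases i <;> simp [pointOver] <;> fun_prop
  have h := (hS.prod (hA.prod isPreconnected_univ)).image _ hg.continuousOn
  convert h using 1
  ext u
  constructor
  · intro hu
    exact ⟨(jet u, u 4, u 5), ⟨hu.1, hu.2, mem_univ _⟩, pointOver_jet u⟩
  · rintro ⟨w, hw, rfl⟩
    exact ⟨by rw [jet_pointOver]; exact hw.1, hw.2.1⟩

theorem pos_or_neg_of_isPreconnected {A : Set Six} (hA : IsPreconnected A)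
    (h : ∀ u ∈ A, u 4 ≠ 0) : (∀ u ∈ A, 0 < u 4) ∨ ∀ u ∈ A, u 4 < 0 := by
  have ho := (hA.image (fun u : Six => u 4)
    (continuous_apply (4 : Fin 6)).continuousOn).ordConnected
  by_contra! hn
  obtain ⟨⟨u, hu, hu'⟩, v, hv, hv'⟩ := hn
  obtain ⟨w, hw, hw'⟩ := ho.out ⟨u, hu, rfl⟩ ⟨v, hv, rfl⟩ ⟨hu', hv'⟩
  exact h w hw hw'

theorem locallyFPEquivAt_iff {F F' : Jet → ℝ} {U U' : Set Jet}
    (hF : ContDiffOn ℝ ∞ F U) (hFqq : ∀ z ∈ U, pd 3 (pd 3 F) z ≠ 0)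
    (hF' : ContDiffOn ℝ ∞ F' U') (hFqq' : ∀ z ∈ U', pd 3 (pd 3 F') z ≠ 0) (z z' : Jet) :
    LocallyFPEquivAt F U z F' U' z' ↔ ∃ ψ : OpenPartialHomeomorph Six Six,
      ψ.source ⊆ P U ∧ ψ.target ⊆ P U' ∧ IsCoframeIso F F' ψ ∧
      ∃ u ∈ ψ.source, jet u = z ∧ jet (ψ u) = z' := by
  constructor
  · rintro ⟨V, V', X, Y, hV, hVU, hzV, hV', hVU', hzV', h, hz⟩
    obtain ⟨ψ, h1, h2, h3, h4⟩ := h.exists_isCoframeIso hV (hF.mono hVU)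
      (fun z hz => hFqq z (hVU hz)) hV' (hF'.mono hVU') fun z hz => hFqq' z (hVU' hz)
    have hu : pointOver z 1 0 ∈ P V := ⟨by rwa [jet_pointOver], one_ne_zero⟩
    refine ⟨ψ, h1 ▸ P_mono hVU, h2 ▸ P_mono hVU', h3, pointOver z 1 0, h1 ▸ hu,
      jet_pointOver z 1 0, ?_⟩
    rw [h4 _ hu, jet_pointOver, hz]
  · rintro ⟨ψ, hs, ht, hψ, u, hu, rfl, rfl⟩
    -- A ball and all its coordinate slices are convex, so the connectedness needed to define X and
    -- Y holds after shrinking.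
    obtain ⟨r, hr, hb⟩ := Metric.isOpen_iff.1 ψ.open_source u hu
    have hcx : ∀ (i : Fin 6) (s : ℝ), Convex ℝ {w : Six | w i = s} := fun i s =>
      convex_hyperplane (dc i).toLinearMap.isLinear s
    have hB := convex_ball u r
    have hub : u ∈ Metric.ball u r := Metric.mem_ball_self hr
    obtain ⟨X, Y, h, hj⟩ := hψ.exists_isFPEquiv hFqq hFqq' ht Metric.isOpen_ball hb (hb.trans hs)
      hB.isPreconnected (fun s => (hB.inter (hcx 0 s)).isPreconnected)
      (fun s t => (hB.inter ((hcx 0 s).inter (hcx 1 t))).isPreconnected)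
    refine ⟨_, _, X, Y, isOpenMap_jet _ Metric.isOpen_ball, ?_, mem_image_of_mem _ hub,
      isOpenMap_jet _ (ψ.isOpen_image_of_subset_source Metric.isOpen_ball hb), ?_,
      mem_image_of_mem _ (mem_image_of_mem _ hub), h, (hj u hub).symm⟩
    · rintro _ ⟨w, hw, rfl⟩
      exact (hs (hb hw)).1
    · rintro _ ⟨_, ⟨w, hw, rfl⟩, rfl⟩
      exact (ht (ψ.map_source (hb hw))).1

theorem exists_isFPEquiv_iff {F F' : Jet → ℝ} {U U' : Set Jet}
    (hU : IsOpen U) (hF : ContDiffOn ℝ ∞ F U) (hFqq : ∀ z ∈ U, pd 3 (pd 3 F) z ≠ 0)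
    (hU' : IsOpen U') (hF' : ContDiffOn ℝ ∞ F' U') (hFqq' : ∀ z ∈ U', pd 3 (pd 3 F') z ≠ 0)
    (hc : IsPreconnected U) (hcx : ∀ s : ℝ, IsPreconnected {z | z ∈ U ∧ z 0 = s})
    (hcxy : ∀ s t : ℝ, IsPreconnected {z | z ∈ U ∧ z 0 = s ∧ z 1 = t}) :
    (∃ (X : ℝ → ℝ) (Y : ℝ × ℝ → ℝ), IsFPEquiv F U F' U' X Y) ↔
      ∃ ψ : OpenPartialHomeomorph Six Six, ψ.source = P U ∧ ψ.target = P U' ∧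
        IsCoframeIso F F' ψ := by
  constructor
  · rintro ⟨X, Y, h⟩
    obtain ⟨ψ, h1, h2, h3, -⟩ := h.exists_isCoframeIso hU hF hFqq hU' hF' hFqq'
    exact ⟨ψ, h1, h2, h3⟩
  · rintro ⟨ψ, hs, ht, hψ⟩
    -- The whole manifold has α of both signs, so its slices are not connected. Each half is, and
    -- the half α > 0 already projects onto U.
    set W : Set Six := {u | jet u ∈ U ∧ u 4 ∈ Ioi (0 : ℝ)} with hWdef
    set N : Set Six := {u | jet u ∈ U ∧ u 4 ∈ Iio (0 : ℝ)} with hNdef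
    have hWP : W ⊆ P U := fun u hu => ⟨hu.1, ne_of_gt hu.2⟩
    have hNP : N ⊆ P U := fun u hu => ⟨hu.1, ne_of_lt hu.2⟩
    have hWo : IsOpen W := (hU.preimage contDiff_jet.continuous).inter
      (isOpen_Ioi.preimage (continuous_apply (4 : Fin 6)))
    have slice : ∀ p : Jet → Prop, IsPreconnected {z | z ∈ U ∧ p z} →
        IsPreconnected {u | u ∈ W ∧ p (jet u)} := by
      intro p hp
      convert isPreconnected_over hp (isPreconnected_Ioi (a := (0 : ℝ))) using 1
      ext u
      simp only [hWdef, mem_ofPred_eq]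
      tauto
    obtain ⟨X, Y, h, -⟩ := hψ.exists_isFPEquiv hFqq hFqq' ht.subset hWo (hs ▸ hWP) hWP
      (isPreconnected_over hc isPreconnected_Ioi) (fun s => slice (fun z => z 0 = s) (hcx s))
      (fun s t => slice (fun z => z 0 = s ∧ z 1 = t) (hcxy s t))
    have e1 : jet '' W = U := by
      refine subset_antisymm (image_subset_iff.2 fun u hu => hu.1) fun z hz => ?_
      exact ⟨pointOver z 1 0, ⟨by rwa [jet_pointOver], mem_Ioi.2 one_pos⟩, jet_pointOver z 1 0⟩
    have hN : IsPreconnected (ψ '' N) :=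
      (isPreconnected_over hc isPreconnected_Iio).image _ (ψ.continuousOn.mono (hs ▸ hNP))
    have hNm : ∀ u ∈ ψ '' N, u 4 ≠ 0 := by
      rintro _ ⟨u, hu, rfl⟩
      exact (ht.subset (ψ.map_source (hs ▸ hNP hu))).2
    have hcover : ∀ w ∈ P U', w ∈ ψ '' W ∨ w ∈ ψ '' N := by
      intro w hw
      have hwt : w ∈ ψ.target := ht ▸ hw
      have hu : ψ.symm w ∈ P U := hs ▸ ψ.map_target hwt
      rcases lt_or_gt_of_ne hu.2 with h4 | h4
      · exact Or.inr ⟨_, ⟨hu.1, h4⟩, ψ.right_inv hwt⟩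
      · exact Or.inl ⟨_, ⟨hu.1, h4⟩, ψ.right_inv hwt⟩
    have e2 : jet '' (ψ '' W) = U' := by
      refine subset_antisymm ?_ fun z hz => ?_
      · rintro _ ⟨_, ⟨u, hu, rfl⟩, rfl⟩
        exact (ht.subset (ψ.map_source (hs ▸ hWP hu))).1
      -- If neither point over z with α = ±1 came from the half α > 0, both would lie in the image
      -- of the other half, which is connected and so has α of one sign.
      · rcases hcover (pointOver z 1 0) ⟨by rwa [jet_pointOver], one_ne_zero⟩ with hp | hp
        · exact ⟨_, hp, jet_pointOver z 1 0⟩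
        rcases hcover (pointOver z (-1) 0)
          ⟨by rwa [jet_pointOver], neg_ne_zero.2 one_ne_zero⟩ with hm | hm
        · exact ⟨_, hm, jet_pointOver z (-1) 0⟩
        rcases pos_or_neg_of_isPreconnected hN hNm with h4 | h4
        · have := h4 _ hm
          rw [pointOver_four] at this
          linarith
        · have := h4 _ hp
          rw [pointOver_four] at this
          linarith
    rw [e1, e2] at h
    exact ⟨X, Y, h⟩

end ThirdOrderODE

end

theorem theorem1 (F F' : ThirdOrderODE.Jet → ℝ) (U U' : Set ThirdOrderODE.Jet)
    (hU : IsOpen U) (hF : ContDiffOn ℝ ∞ F U)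
    (hFqq : ∀ z ∈ U, ThirdOrderODE.pd 3 (ThirdOrderODE.pd 3 F) z ≠ 0)
    (hU' : IsOpen U') (hF' : ContDiffOn ℝ ∞ F' U')
    (hFqq' : ∀ z ∈ U', ThirdOrderODE.pd 3 (ThirdOrderODE.pd 3 F') z ≠ 0) :
    -- The explicit forms are a smooth coframe on `P`.
    ((∀ i, ContDiffOn ℝ ∞ (fun u => ThirdOrderODE.coframe F u i) (ThirdOrderODE.P U)) ∧
      ∀ u ∈ ThirdOrderODE.P U, LinearIndependent ℝ (ThirdOrderODE.coframe F u)) ∧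
    -- They are the unique normalized reduction.
    ((ThirdOrderODE.canonical F).IsNormalized F U ∧
      ∀ R : ThirdOrderODE.Reduction, R.IsNormalized F U → ∀ u ∈ ThirdOrderODE.P U,
        R.β u = (ThirdOrderODE.canonical F).β u ∧ R.ε u = (ThirdOrderODE.canonical F).ε u ∧
        R.η u = (ThirdOrderODE.canonical F).η u ∧ R.κ u = (ThirdOrderODE.canonical F).κ u ∧
        R.lam u = (ThirdOrderODE.canonical F).lam u ∧
        R.Om1 u = (ThirdOrderODE.canonical F).Om1 u ∧
        R.Om2 u = (ThirdOrderODE.canonical F).Om2 u) ∧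
    -- Invariance: each fiber-preserving equivalence lifts uniquely to an isomorphism of coframes.
    (∀ (X : ℝ → ℝ) (Y : ℝ × ℝ → ℝ), ThirdOrderODE.IsFPEquiv F U F' U' X Y →
      ∃ ψ : OpenPartialHomeomorph ThirdOrderODE.Six ThirdOrderODE.Six,
        (ψ.source = ThirdOrderODE.P U ∧ ψ.target = ThirdOrderODE.P U' ∧
          ThirdOrderODE.IsCoframeIso F F' ψ ∧
          ∀ u ∈ ThirdOrderODE.P U,
            ThirdOrderODE.jet (ψ u) = ThirdOrderODE.prolong X Y (ThirdOrderODE.jet u)) ∧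
        ∀ φ : OpenPartialHomeomorph ThirdOrderODE.Six ThirdOrderODE.Six,
          φ.source = ThirdOrderODE.P U → φ.target = ThirdOrderODE.P U' →
          ThirdOrderODE.IsCoframeIso F F' φ →
          (∀ u ∈ ThirdOrderODE.P U,
            ThirdOrderODE.jet (φ u) = ThirdOrderODE.prolong X Y (ThirdOrderODE.jet u)) →
          Set.EqOn φ ψ (ThirdOrderODE.P U)) ∧
    -- Local equivalence of the equations is local equivalence of the coframes.
    (∀ z ∈ U, ∀ z' ∈ U',
      (ThirdOrderODE.LocallyFPEquivAt F U z F' U' z' ↔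
        ∃ ψ : OpenPartialHomeomorph ThirdOrderODE.Six ThirdOrderODE.Six,
          ψ.source ⊆ ThirdOrderODE.P U ∧ ψ.target ⊆ ThirdOrderODE.P U' ∧
          ThirdOrderODE.IsCoframeIso F F' ψ ∧
          ∃ u ∈ ψ.source, ThirdOrderODE.jet u = z ∧ ThirdOrderODE.jet (ψ u) = z')) ∧
    -- Global equivalence, over a connected domain with connected fibers over `x` and `(x, y)`.
    (IsPreconnected U →
      (∀ s : ℝ, IsPreconnected {z | z ∈ U ∧ z 0 = s}) →
      (∀ s t : ℝ, IsPreconnected {z | z ∈ U ∧ z 0 = s ∧ z 1 = t}) →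
      ((∃ (X : ℝ → ℝ) (Y : ℝ × ℝ → ℝ), ThirdOrderODE.IsFPEquiv F U F' U' X Y) ↔
        ∃ ψ : OpenPartialHomeomorph ThirdOrderODE.Six ThirdOrderODE.Six,
          ψ.source = ThirdOrderODE.P U ∧ ψ.target = ThirdOrderODE.P U' ∧
          ThirdOrderODE.IsCoframeIso F F' ψ)) := by
  exact ⟨⟨ThirdOrderODE.contDiffOn_coframe hU hF hFqq,
      fun _ hu => ThirdOrderODE.linearIndependent_coframe hu.2 (hFqq _ hu.1)⟩,
    ⟨ThirdOrderODE.isNormalized_canonical hU hF hFqq,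
      fun _ hR _ hu => hR.eq_canonical hU hF hFqq hu⟩,
    fun X Y h => by
      obtain ⟨ψ, h1, h2, h3, h4⟩ := h.exists_isCoframeIso hU hF hFqq hU' hF' hFqq'
      refine ⟨ψ, ⟨h1, h2, h3, h4⟩, fun φ e1 _ e3 e4 u hu => ?_⟩
      rw [h.eq_lift hU hFqq e1 e3 e4 hu, h.eq_lift hU hFqq h1 h3 h4 hu],
    fun z _ z' _ => ThirdOrderODE.locallyFPEquivAt_iff hF hFqq hF' hFqq' z z',
    ThirdOrderODE.exists_isFPEquiv_iff hU hF hFqq hU' hF' hFqq'⟩
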